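/- **Model.** Base stations (BSs) form a homogeneous Poisson point process of intensity $\lambda_{BS}>0$ in $\mathbb R^2$; the typical user is at the origin. A link of length at most $D>0$ is independently LOS ($\mathrm L$) with probability $p_{LOS}\in[0,1]$ and NLOS ($\mathrm N$) otherwise; links longer than $D$ are NLOS. A link of type $j\in\{\mathrm L,\mathrm N\}$ and length $r$ has path loss $L=10^{(\beta+10\alpha_j\log_{10}r+s)/10}$ with $\beta=20\log_{10}(4\pi/\lambda_c)$ and independent shadowing $s\sim N(0,\xi_j^2)$ ($\alpha_j,\xi_j,\lambda_c>0$), and has $\eta_j\ge1$ paths with i.i.d. complex normal gains $\gamma_i$ of mean $0$ and unit variance. The user is served by the BS $x$ of least path loss. The load $N_x$ of that BS has, with $\rho=\lambda_{UE}/\lambda_{BS}$ ($\lambda_{UE}>0$ the user density), the PMF $\kappa(0)=0$, $$\kappa(n)=\frac{3.5^{3.5}}{(n-1)!}\frac{\Gamma(n+3.5)}{\Gamma(3.5)}\rho^{n-1}(3.5+\rho)^{-n-3.5}\qquad(n\ge1),$$ and $U_x=\min(U_M,N_x)$ users are served per time slot ($U_M\ge1$). With transmit power $\mathrm P>0$,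 noise power $\sigma_n^2>0$, $N_{BS},N_{UE}\ge1$ antennas and $G=\mathrm P N_{BS}N_{UE}$, the SNR of the typical user is $$\mathrm{SNR}_{x,0}=\frac{G}{\eta_jU_x\sigma_n^2}\max_{i\le\eta_j}|\gamma_i|^2\,L^{-1}\,p_{MU},$$ where $j$, $\gamma_i$, $L$ belong to the serving link and the zero-forcing penalty $p_{MU}$ is, given $j$ and $U_x$, Bernoulli with success probability $\zeta(\eta_j,U_x)$. The locations, LOS states of links within $D$, shadowings, gains, zero-forcing penalties and the load are otherwise mutually independent. The network is noise-limited ($\mathrm{SINR}=\mathrm{SNR}$), so the rate of the user is $R_{x,0}=\omega_{MU}\,\mathrm B\,\frac{U_x}{N_x}\log_2(1+\mathrm{SNR}_{x,0})$ with bandwidth $\mathrm B>0$ and efficiency $\omega_{MU}>0$. Here, for $a\in\{BS,UE\}$, $q_{a,i}=\frac1\pi\left(\arcsin(-1+\frac{2i+1}{N_a})-\arcsin(-1+\frac{2i-1}{N_a})\right)$ for $1\le i<N_a$, $q_{a,N_a}=1-\sum_{i<N_a}q_{a,i}$, and $$\zeta(\eta,U)=\sum_{j=1}^{N_{BS}}q_{BS,j}B_j(\eta,U)\big(p_{LOS}A_j(\eta_{\mathrm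 L})+(1-p_{LOS})A_j(\eta_{\mathrm N})\big)^{U-1},$$ $C(\eta)=\sum_{i=1}^{N_{UE}}q_{UE,i}(1-q_{UE,i})^{\eta-1}$, $A_j(\eta)=C(\eta)+(1-q_{BS,j})^{\eta-1}(1-C(\eta))$, $B_j(\eta,U)=C(\eta)(1-q_{BS,j})^{U-1}+D_j(\eta,U)(1-C(\eta))$, $$D_j(\eta,U)=\sum_{i_1,\dots,i_{\eta-1}=1}^{N_{BS}-1}\Big(\prod_{n=1}^{\eta-1}l_{i_n,j}\Big)\Big(1-\sum_{v\in\{i_1,\dots,i_{\eta-1}\}}l_{v,j}\Big)^{U-1},$$ where the inner sum is over distinct values, $l_{n,j}=q_{BS,n}/(1-q_{BS,j})$ for $n<j$ and $l_{n,j}=q_{BS,n+1}/(1-q_{BS,j})$ for $n\ge j$. Let $\mathrm Q$ be the standard Gaussian complementary distribution function, $m=-0.1\beta\ln10$, $\sigma_j=0.1\xi_j\ln10$, $\Upsilon_j(t)=\frac{\ln(D^{\alpha_j}/t)-m}{\sigma_j}$, $e_j(t)=t^{2/\alpha_j}\exp\left(\frac{2\sigma_j^2}{\alpha_j^2}+\frac{2m}{\alpha_j}\right)$,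 $$M_{\mathrm L}(t)=\pi p_{LOS}\Big[D^2\mathrm Q(\Upsilon_{\mathrm L}(t))+e_{\mathrm L}(t)\,\mathrm Q\Big(\frac{2\sigma_{\mathrm L}}{\alpha_{\mathrm L}}-\Upsilon_{\mathrm L}(t)\Big)\Big],$$ $$M_{\mathrm N}(t)=-\pi p_{LOS}D^2\mathrm Q(\Upsilon_{\mathrm N}(t))+\pi e_{\mathrm N}(t)\Big[1-p_{LOS}\,\mathrm Q\Big(\frac{2\sigma_{\mathrm N}}{\alpha_{\mathrm N}}-\Upsilon_{\mathrm N}(t)\Big)\Big],$$ $\mathrm B_{\mathrm L}=1-e^{-\lambda_{BS}\pi p_{LOS}D^2}$, $\mathrm B_{\mathrm N}=1$, $f_j(t)=\lambda_{BS}e^{-\lambda_{BS}M_j(t)}M_j'(t)/\mathrm B_j$ (read as $0$ if $\mathrm B_j=0$), and, with $\bar j$ the other link type, $$\mathcal S(\tau,U)=\sum_{j\in\{\mathrm L,\mathrm N\}}\mathrm B_j\,\zeta(\eta_j,U)\sum_{n=1}^{\eta_j}(-1)^{n+1}\binom{\eta_j}{n}\int_0^\infty\exp\Big(-\frac{\eta_j\tau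 nUl\sigma_n^2}{G}-\lambda_{BS}M_{\bar j}(l)\Big)f_j(l)\,dl.$$ **Theorem.** For every $\tau_r\ge0$ the integrals in the terms below converge, the series converges, and $$\mathbb P(R_{x,0}>\tau_r)=\sum_{n\ge1}\kappa(n)\,\mathcal S\Big(2^{\frac{\tau_rn}{\omega_{MU}\mathrm B\min(n,U_M)}}-1,\ \min(n,U_M)\Big).$$ -/

import Mathlib

open MeasureTheory ProbabilityTheory Set
open scoped Nat NNReal ENNReal BigOperators

noncomputable section

namespace MmWave

/-- Line-of-sight and non-line-of-sight links. -/
inductive LinkType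
  | los
  | nlos

/-- The other link type. -/
def LinkType.other : LinkType → LinkType
  | .los => .nlos
  | .nlos => .los

/-- Deterministic parameters of the downlink network. -/
structure Params where
  /-- density of base stations (BSs) per unit area -/
  lamBS : ℝ
  /-- density of users (UEs) per unit area -/
  lamUE : ℝ
  /-- probability that a link of length at most `D` is LOS -/
  pLOS : ℝ
  /-- LOS ball radius -/
  D : ℝ
  /-- carrier wavelength, in meters -/
  wavelength : ℝ
  /-- path loss exponent -/
  α : LinkType → ℝ
  /-- standard deviation (in dB) of the shadowing -/
  ξ : LinkType → ℝ
  /-- number of paths of a link -/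
  η : LinkType → ℕ
  /-- number of antennas at a BS -/
  NBS : ℕ
  /-- number of antennas at a user -/
  NUE : ℕ
  /-- maximal number of users that a BS schedules in one time slot -/
  UM : ℕ
  /-- transmit power -/
  power : ℝ
  /-- noise power -/
  noise : ℝ
  /-- bandwidth -/
  bandwidth : ℝ
  /-- efficiency factor of multi-user MIMO -/
  eff : ℝ
  lamBS_pos : 0 < lamBS
  lamUE_pos : 0 < lamUE
  pLOS_nonneg : 0 ≤ pLOS
  pLOS_le_one : pLOS ≤ 1
  D_pos : 0 < D
  wavelength_pos : 0 < wavelength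
  α_pos : ∀ j, 0 < α j
  ξ_pos : ∀ j, 0 < ξ j
  η_pos : ∀ j, 0 < η j
  NBS_pos : 0 < NBS
  NUE_pos : 0 < NUE
  UM_pos : 0 < UM
  power_pos : 0 < power
  noise_pos : 0 < noise
  bandwidth_pos : 0 < bandwidth
  eff_pos : 0 < eff

/-! ### Zero-forcing penalty -/

/-- Probability of the `i`-th quantized virtual angle, `1 ≤ i ≤ N`, of an array of `N` antennas. -/
def angleProb (N i : ℕ) : ℝ :=
  if i < N then
    (Real.arcsin (-1 + (2 * i + 1) / N) - Real.arcsin (-1 + (2 * i - 1) / N)) / Real.pi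
  else
    1 - ∑ k ∈ Finset.Icc 1 (N - 1),
      (Real.arcsin (-1 + (2 * k + 1) / N) - Real.arcsin (-1 + (2 * k - 1) / N)) / Real.pi

namespace Params

variable (P : Params)

/-- `q_{BS,j}` -/
def qBS (j : ℕ) : ℝ := angleProb P.NBS j

/-- `q_{UE,i}` -/
def qUE (i : ℕ) : ℝ := angleProb P.NUE i

/-- `C(η)` -/
def zfC (η : ℕ) : ℝ := ∑ i ∈ Finset.Icc 1 P.NUE, P.qUE i * (1 - P.qUE i) ^ (η - 1)

/-- `A_j(η)` -/
def zfA (j η : ℕ) : ℝ :=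
  P.zfC η + (1 - P.qBS j) ^ (η - 1) - (1 - P.qBS j) ^ (η - 1) * P.zfC η

/-- `l_{n,j}` -/
def zfl (n j : ℕ) : ℝ :=
  if n < j then P.qBS n / (1 - P.qBS j) else P.qBS (n + 1) / (1 - P.qBS j)

/-- `D_j(η, U)`: the sum over all `(i_1, …, i_{η-1})` in `{1, …, NBS - 1}^{η-1}`; the inner sum is
over the distinct values among the `i_n`. -/
def zfD (j η U : ℕ) : ℝ :=
  ∑ i ∈ Fintype.piFinset (fun _ : Fin (η - 1) => Finset.Icc 1 (P.NBS - 1)),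
    (∏ n, P.zfl (i n) j) * (1 - ∑ v ∈ Finset.univ.image i, P.zfl v j) ^ (U - 1)

/-- `B_j(η, U)` -/
def zfB (j η U : ℕ) : ℝ :=
  P.zfC η * (1 - P.qBS j) ^ (U - 1) + P.zfD j η U - P.zfD j η U * P.zfC η

/-- `ζ(η, U)` -/
def zeta (η U : ℕ) : ℝ :=
  ∑ j ∈ Finset.Icc 1 P.NBS, P.qBS j * P.zfB j η U *
    (P.pLOS * P.zfA j (P.η .los) + (1 - P.pLOS) * P.zfA j (P.η .nlos)) ^ (U - 1)

/-! ### Load -/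

/-- `κ(n)`, the PMF of the number of users of the BS that serves the typical user. -/
def kappa (n : ℕ) : ℝ :=
  if n = 0 then 0
  else (3.5 : ℝ) ^ (3.5 : ℝ) / ((n - 1)! : ℕ) * (Real.Gamma (n + 3.5) / Real.Gamma 3.5) *
    (P.lamUE / P.lamBS) ^ (n - 1) * (3.5 + P.lamUE / P.lamBS) ^ (-(n : ℝ) - 3.5)

/-! ### Path loss and the SNR coverage function -/

/-- `β`, the path loss in dB at one meter. -/
def β : ℝ := 20 * Real.logb 10 (4 * Real.pi / P.wavelength)

/-- Path loss (linear scale) of a link of type `j`, length `r` and shadowing `s` (in dB). -/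
def pathLoss (j : LinkType) (r s : ℝ) : ℝ :=
  (10 : ℝ) ^ ((P.β + 10 * P.α j * Real.logb 10 r + s) / 10)

/-- `G` -/
def G : ℝ := P.power * P.NBS * P.NUE

/-- `m` -/
def m : ℝ := -(0.1 * P.β * Real.log 10)

/-- `σ_j` -/
def σ (j : LinkType) : ℝ := 0.1 * P.ξ j * Real.log 10

/-- `Υ_j(t)` -/
def Upsilon (j : LinkType) (t : ℝ) : ℝ := (Real.log (P.D ^ P.α j / t) - P.m) / P.σ j

end Params

/-- The Q-function: complementary distribution function of the standard Gaussian law. -/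
def Q (x : ℝ) : ℝ := (gaussianReal 0 1).real (Ioi x)

namespace Params

variable (P : Params)

/-- `M_L(t)` and `M_N(t)` -/
def M : LinkType → ℝ → ℝ
  | .los, t => Real.pi * P.pLOS *
      (P.D ^ 2 * Q (P.Upsilon .los t) +
        t ^ (2 / P.α .los) *
          Real.exp (2 * P.σ .los ^ 2 / P.α .los ^ 2 + 2 * P.m / P.α .los) *
          Q (2 * P.σ .los ^ 2 / (P.α .los * P.σ .los) - P.Upsilon .los t))
  | .nlos, t => -(Real.pi * P.pLOS * P.D ^ 2 * Q (P.Upsilon .nlos t)) +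
      Real.pi * t ^ (2 / P.α .nlos) *
        Real.exp (2 * P.σ .nlos ^ 2 / P.α .nlos ^ 2 + 2 * P.m / P.α .nlos) *
        (1 - P.pLOS * Q (2 * P.σ .nlos ^ 2 / (P.α .nlos * P.σ .nlos) - P.Upsilon .nlos t))

/-- `M'_L(t)` and `M'_N(t)`; the factor `pLOS` is multiplied into the brackets of `M'_N`, so that
the formula makes sense for `pLOS = 0` too. -/
def M' : LinkType → ℝ → ℝ
  | .los, t => Real.pi * P.pLOS *
      (Real.exp (2 * P.σ .los ^ 2 / P.α .los ^ 2 + 2 * P.m / P.α .los) *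
          t ^ (2 / P.α .los - 1) *
          (2 / P.α .los * Q (2 * P.σ .los ^ 2 / (P.α .los * P.σ .los) - P.Upsilon .los t) -
            1 / √(2 * Real.pi * P.σ .los ^ 2) *
              Real.exp (-(√2 * P.σ .los / P.α .los - P.Upsilon .los t / √2) ^ 2)) +
        P.D ^ 2 / (√(2 * Real.pi) * t * P.σ .los) * Real.exp (-(P.Upsilon .los t ^ 2 / 2)))
  | .nlos, t => Real.pi *
      (Real.exp (2 * P.σ .nlos ^ 2 / P.α .nlos ^ 2 + 2 * P.m / P.α .nlos) *
          t ^ (2 / P.α .nlos - 1) *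
          (2 / P.α .nlos - P.pLOS *
            (2 / P.α .nlos *
                Q (2 * P.σ .nlos ^ 2 / (P.α .nlos * P.σ .nlos) - P.Upsilon .nlos t) -
              1 / √(2 * Real.pi * P.σ .nlos ^ 2) *
                Real.exp (-(√2 * P.σ .nlos / P.α .nlos - P.Upsilon .nlos t / √2) ^ 2))) -
        P.pLOS *
          (P.D ^ 2 / (√(2 * Real.pi) * t * P.σ .nlos) * Real.exp (-(P.Upsilon .nlos t ^ 2 / 2))))

/-- `B_L` and `B_N`, the probability that there is a BS with a link of the given type. -/
def B : LinkType → ℝ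
  | .los => 1 - Real.exp (-(P.lamBS * Real.pi * P.pLOS * P.D ^ 2))
  | .nlos => 1

/-- `f_L` and `f_N`, density of the least path loss among the links of the given type. -/
def f (j : LinkType) (t : ℝ) : ℝ :=
  P.lamBS * Real.exp (-(P.lamBS * P.M j t)) * P.M' j t / P.B j

/-- The integrand in `S(τ, U)`. -/
def covIntegrand (j : LinkType) (τ : ℝ) (U n : ℕ) (l : ℝ) : ℝ :=
  Real.exp (-(P.η j * τ * n * U * l * P.noise / P.G) - P.lamBS * P.M j.other l) * P.f j l

/-- The summand of `S(τ, U)` that belongs to link type `j`. -/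
def covTerm (j : LinkType) (τ : ℝ) (U : ℕ) : ℝ :=
  P.B j * P.zeta (P.η j) U *
    ∑ n ∈ Finset.Icc 1 (P.η j), (-1 : ℝ) ^ (n + 1) * (P.η j).choose n *
      ∫ l in Ioi (0 : ℝ), P.covIntegrand j τ U n l

/-- `S(τ, U)` -/
def S (τ : ℝ) (U : ℕ) : ℝ := P.covTerm .los τ U + P.covTerm .nlos τ U

/-- The SNR threshold for rate `τ` at a user whose BS has load `n`. -/
def snrThreshold (τ : ℝ) (n : ℕ) : ℝ :=
  (2 : ℝ) ^ (τ * n / (P.eff * P.bandwidth * (min n P.UM : ℕ))) - 1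

end Params

/-! ### The random network -/

/-- The random points `X 0, X 1, …` form a Poisson point process with intensity measure `Λ`: the
numbers of points in disjoint sets of finite intensity are independent Poisson variables. -/
structure IsPoissonProcess {Ω E : Type*} [MeasurableSpace Ω] [MeasurableSpace E]
    (X : ℕ → Ω → E) (Λ : Measure E) (μ : Measure Ω) : Prop where
  measurable : ∀ i, Measurable (X i)
  count : ∀ (k : ℕ) (A : Fin k → Set E), (∀ a, MeasurableSet (A a)) →
    Pairwise (fun a b => Disjoint (A a) (A b)) → (∀ a, Λ (A a) ≠ ∞) → ∀ n : Fin k → ℕ,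
    μ.real {ω | ∀ a, {i | X i ω ∈ A a}.encard = (n a : ℕ∞)} =
      ∏ a, Real.exp (-(Λ (A a)).toReal) * (Λ (A a)).toReal ^ n a / (n a)!

/-- The circularly symmetric complex normal law with mean zero and unit variance. -/
def complexNormal : Measure ℂ :=
  ((gaussianReal 0 (1 / 2)).prod (gaussianReal 0 (1 / 2))).map (fun z => (⟨z.1, z.2⟩ : ℂ))

/-- The random network as seen from the typical user, who is at the origin. -/
structure Network (P : Params) {Ω : Type*} [MeasurableSpace Ω] (μ : Measure Ω) where
  /-- locations of the BSs -/
  loc : ℕ → Ω → EuclideanSpace ℝ (Fin 2)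
  /-- the link to BS `i` is LOS if it is unblocked and has length at most `D` -/
  unblocked : ℕ → Ω → Bool
  /-- `shadow j i` is the shadowing (in dB) on the link to BS `i` if that link has type `j` -/
  shadow : LinkType → ℕ → Ω → ℝ
  /-- `fading i k` is the small scale fading on path `k` of the link to BS `i` -/
  fading : ℕ → ℕ → Ω → ℂ
  /-- `zf j U` is the zero-forcing penalty on a serving link of type `j` when the serving BS serves
  `U` users in the time slot -/
  zf : LinkType → ℕ → Ω → ℝ
  /-- number of users of the BS that serves the typical user -/
  load : Ω → ℕ
  loc_poisson : IsPoissonProcess loc (ENNReal.ofReal P.lamBS • volume) μ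
  unblocked_measurable : ∀ i, Measurable (unblocked i)
  unblocked_law : ∀ i, μ.real {ω | unblocked i ω = true} = P.pLOS
  unblocked_indep : iIndepFun unblocked μ
  shadow_measurable : ∀ j i, Measurable (shadow j i)
  shadow_law : ∀ j i, μ.map (shadow j i) = gaussianReal 0 (Real.toNNReal (P.ξ j ^ 2))
  shadow_indep : iIndepFun (fun a : LinkType × ℕ => shadow a.1 a.2) μ
  fading_measurable : ∀ i k, Measurable (fading i k)
  fading_law : ∀ i k, μ.map (fading i k) = complexNormal
  fading_indep : iIndepFun (fun a : ℕ × ℕ => fading a.1 a.2) μ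
  zf_measurable : ∀ j U, Measurable (zf j U)
  zf_range : ∀ j U ω, zf j U ω = 0 ∨ zf j U ω = 1
  zf_law : ∀ j U, 1 ≤ U → μ.real {ω | zf j U ω = 1} = P.zeta (P.η j) U
  load_measurable : Measurable load
  load_law : ∀ n, μ.real {ω | load ω = n} = P.kappa n
  /- The next five fields together: the six sources of randomness are mutually independent. -/
  indep_loc : IndepFun (fun ω i => loc i ω) (fun ω => (fun i => unblocked i ω,
    fun j i => shadow j i ω, fun i k => fading i k ω, fun j U => zf j U ω, load ω)) μ
  indep_unblocked : IndepFun (fun ω i => unblocked i ω) (fun ω =>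
    (fun j i => shadow j i ω, fun i k => fading i k ω, fun j U => zf j U ω, load ω)) μ
  indep_shadow : IndepFun (fun ω j i => shadow j i ω) (fun ω =>
    (fun i k => fading i k ω, fun j U => zf j U ω, load ω)) μ
  indep_fading : IndepFun (fun ω i k => fading i k ω) (fun ω =>
    (fun j U => zf j U ω, load ω)) μ
  indep_zf : IndepFun (fun ω j U => zf j U ω) load μ

namespace Network

variable {P : Params} {Ω : Type*} [MeasurableSpace Ω] {μ : Measure Ω} (W : Network P μ)

/-- Type of the link from BS `i` to the typical user. -/
def linkType (i : ℕ) (ω : Ω) : LinkType :=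
  open Classical in if W.unblocked i ω = true ∧ ‖W.loc i ω‖ ≤ P.D then .los else .nlos

/-- Path loss from BS `i` to the typical user. -/
def loss (i : ℕ) (ω : Ω) : ℝ :=
  P.pathLoss (W.linkType i ω) ‖W.loc i ω‖ (W.shadow (W.linkType i ω) i ω)

/-- The tagged BS: the (first) one that offers the minimal path loss. -/
def tagged (ω : Ω) : ℕ := sInf {i | ∀ k, W.loss i ω ≤ W.loss k ω}

/-- Type of the serving link. -/
def servingType (ω : Ω) : LinkType := W.linkType (W.tagged ω) ω

/-- Number of users that the tagged BS serves in a time slot. -/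
def numServed (ω : Ω) : ℕ := min P.UM (W.load ω)

/-- The strongest fading power among the paths of the serving link. -/
def bestFading (ω : Ω) : ℝ :=
  ⨆ k : Fin (P.η (W.servingType ω)), ‖W.fading (W.tagged ω) k ω‖ ^ 2

/-- SNR of the typical user. -/
def snr (ω : Ω) : ℝ :=
  P.G / (P.η (W.servingType ω) * W.numServed ω * P.noise) * W.bestFading ω *
    (W.loss (W.tagged ω) ω)⁻¹ * W.zf (W.servingType ω) (W.numServed ω) ω

/-- Rate of the typical user in the noise-limited network (where SINR = SNR). -/
def rate (ω : Ω) : ℝ :=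
  P.eff * (P.bandwidth * W.numServed ω / W.load ω) * Real.logb 2 (1 + W.snr ω)

end Network

end MmWave

end

/-!
Base stations, together with the independent shadowings and blockages of their links, form a Poisson
process of links; the passage from locations to links goes through the probability generating
functional. The links of type `j` with path loss at most `t` are `λ_BS M_j(t)` in the mean, where
the log-normal integral over the shadowing is computed by exponential tilting of the Gaussian law.
Links of different types form disjoint regions, so the least path losses of the two types are
independent with tails `exp (-λ_BS M_j(t))`, and the smaller of the two belongs to the serving link.
Given a serving link of type `j` and path loss `l`, the strongest of its `η_j` exponentially
distributed fading powers exceeds `x` with probability `1 - (1 - exp (-x)) ^ η_j`, whose binomial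
expansion yields the alternating sum in `S`. Conditioning on the load turns this into the series.
-/

namespace MmWave

open Filter Topology

section Independence

variable {Ω α β γ ι κ : Type*} [MeasurableSpace Ω] [MeasurableSpace α] [MeasurableSpace β]
  [MeasurableSpace γ] {μ : Measure Ω}

lemma lintegral_comp_prodMk_of_indepFun [IsFiniteMeasure μ] {X : Ω → α} {Y : Ω → β}
    (hX : Measurable X) (hY : Measurable Y) (h : IndepFun X Y μ) {F : α → β → ℝ≥0∞}
    (hF : Measurable (Function.uncurry F)) :
    ∫⁻ ω, F (X ω) (Y ω) ∂μ = ∫⁻ ω, ∫⁻ y, F (X ω) y ∂(μ.map Y) ∂μ := by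
  calc ∫⁻ ω, F (X ω) (Y ω) ∂μ
      = ∫⁻ z, Function.uncurry F z ∂(μ.map fun ω => (X ω, Y ω)) :=
        (lintegral_map hF (hX.prodMk hY)).symm
    _ = ∫⁻ x, ∫⁻ y, F x y ∂(μ.map Y) ∂(μ.map X) := by
        rw [h.map_prod_eq_prod_map_map hX.aemeasurable hY.aemeasurable,
          lintegral_prod _ hF.aemeasurable]
        rfl
    _ = ∫⁻ ω, ∫⁻ y, F (X ω) y ∂(μ.map Y) ∂μ := lintegral_map hF.lintegral_prod_right hX

lemma measure_prodMk_mem_of_indepFun [IsFiniteMeasure μ] {X : Ω → α} {Y : Ω → β}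
    (hX : Measurable X) (hY : Measurable Y) (h : IndepFun X Y μ) {A : Set (α × β)}
    (hA : MeasurableSet A) :
    μ {ω | (X ω, Y ω) ∈ A} = ∫⁻ ω, μ {ω' | (X ω, Y ω') ∈ A} ∂μ := by
  calc μ {ω | (X ω, Y ω) ∈ A}
      = (μ.map X).prod (μ.map Y) A := by
        rw [← h.map_prod_eq_prod_map_map hX.aemeasurable hY.aemeasurable,
          Measure.map_apply (hX.prodMk hY) hA]
        rfl
    _ = ∫⁻ ω, μ.map Y (Prod.mk (X ω) ⁻¹' A) ∂μ := by
        rw [Measure.prod_apply hA, lintegral_map (measurable_measure_prodMk_left hA) hX]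
    _ = ∫⁻ ω, μ {ω' | (X ω, Y ω') ∈ A} ∂μ :=
        lintegral_congr fun ω => Measure.map_apply hY (measurable_prodMk_left hA)

lemma indepFun_prodMk_left [IsProbabilityMeasure μ] {X : Ω → α} {Y : Ω → β} {Z : Ω → γ}
    (hX : Measurable X) (hY : Measurable Y) (hZ : Measurable Z)
    (h : IndepFun X (fun ω => (Y ω, Z ω)) μ) (h' : IndepFun Y Z μ) :
    IndepFun (fun ω => (X ω, Y ω)) Z μ := by
  have hXY : IndepFun X Y μ := h.comp measurable_id measurable_fst
  have := Measure.isProbabilityMeasure_map (μ := μ) hX.aemeasurable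
  have := Measure.isProbabilityMeasure_map (μ := μ) hY.aemeasurable
  have := Measure.isProbabilityMeasure_map (μ := μ) hZ.aemeasurable
  refine (indepFun_iff_map_prod_eq_prod_map_map (hX.prodMk hY).aemeasurable hZ.aemeasurable).2 ?_
  apply (MeasurableEquiv.prodAssoc : (α × β) × γ ≃ᵐ α × β × γ).map_measurableEquiv_injective
  calc (μ.map fun ω => ((X ω, Y ω), Z ω)).map MeasurableEquiv.prodAssoc
      = μ.map fun ω => (X ω, Y ω, Z ω) :=
        Measure.map_map (MeasurableEquiv.measurable _) ((hX.prodMk hY).prodMk hZ)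
    _ = (μ.map X).prod ((μ.map Y).prod (μ.map Z)) := by
        rw [h.map_prod_eq_prod_map_map hX.aemeasurable (hY.prodMk hZ).aemeasurable,
          h'.map_prod_eq_prod_map_map hY.aemeasurable hZ.aemeasurable]
    _ = _ := by
        rw [hXY.map_prod_eq_prod_map_map hX.aemeasurable hY.aemeasurable, Measure.prodAssoc_prod]

lemma iIndepFun_curry {X : ι → κ → Ω → α} (hX : ∀ i k, Measurable (X i k))
    (h : iIndepFun (fun p : ι × κ => X p.1 p.2) μ) : iIndepFun (fun i ω k => X i k ω) μ := by
  have := h.isProbabilityMeasure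
  have (i : ι) (k : κ) := Measure.isProbabilityMeasure_map (μ := μ) (hX i k).aemeasurable
  have hrow (i : ι) : iIndepFun (X i) μ :=
    h.precomp (g := Prod.mk i) (Prod.mk_right_injective i)
  rw [iIndepFun_iff_map_fun_eq_infinitePi_map fun i => measurable_pi_iff.2 (hX i)]
  simp_rw [fun i => (hrow i).map_fun_eq_infinitePi_map (hX i)]
  have hlaw : μ.map (fun ω (p : ι × κ) => X p.1 p.2 ω) =
      .infinitePi fun p => μ.map (X p.1 p.2) :=
    h.map_fun_eq_infinitePi_map fun p => hX p.1 p.2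
  rw [← Measure.infinitePi_map_curry fun i k => μ.map (X i k), ← hlaw,
    Measure.map_map (MeasurableEquiv.measurable _)
      (measurable_pi_iff.2 fun p : ι × κ => hX p.1 p.2)]
  rfl

lemma indepFun_of_measure_lt_and_lt [IsProbabilityMeasure μ] {X Y : Ω → ℝ≥0∞} (hX : Measurable X)
    (hY : Measurable Y) (h : ∀ s t : ℝ≥0, μ {ω | s < X ω ∧ t < Y ω} =
      μ {ω | s < X ω} * μ {ω | t < Y ω}) : IndepFun X Y μ := by
  have hgen (Z : Ω → ℝ≥0∞) : MeasurableSpace.comap Z inferInstance =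
      .generateFrom {s | ∃ t ∈ range (Ioi : ℝ≥0∞ → Set ℝ≥0∞), Z ⁻¹' t = s} := by
    rw [BorelSpace.measurable_eq (α := ℝ≥0∞), borel_eq_generateFrom_Ioi,
      MeasurableSpace.comap_generateFrom]
    rfl
  refine IndepSets.indep hX.comap_le hY.comap_le (isPiSystem_Ioi.comap X) (isPiSystem_Ioi.comap Y)
    (hgen X) (hgen Y) ((IndepSets_iff _ _ _).2 ?_)
  rintro _ _ ⟨_, ⟨s, rfl⟩, rfl⟩ ⟨_, ⟨t, rfl⟩, rfl⟩
  induction s with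
  | top => simp
  | coe s =>
    induction t with
    | top => simp
    | coe t => exact h s t

lemma ae_ne_of_indepFun [IsFiniteMeasure μ] [MeasurableEq α] {X Y : Ω → α} (hX : Measurable X)
    (hY : Measurable Y) (h : IndepFun X Y μ) {s : Set α} (hs : MeasurableSet s)
    (h0 : ∀ x ∈ s, μ {ω | Y ω = x} = 0) : ∀ᵐ ω ∂μ, X ω ∈ s → Y ω ≠ X ω := by
  let A : Set (α × α) := {z | z.1 ∈ s ∧ z.2 = z.1}
  have hA : MeasurableSet A := by
    simp only [A, ofPred_and]
    exact (measurable_fst hs).inter (measurableSet_eq_fun measurable_snd measurable_fst)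
  have hnull : μ {ω | (X ω, Y ω) ∈ A} = 0 := by
    rw [measure_prodMk_mem_of_indepFun hX hY h hA]
    refine (lintegral_congr fun ω => ?_).trans lintegral_zero
    by_cases hω : X ω ∈ s
    · simpa [A, hω] using h0 _ hω
    · simp [A, hω]
  filter_upwards [compl_mem_ae_iff.2 hnull] with ω hω hs heq
  exact hω ⟨hs, heq⟩

lemma setLIntegral_lt_of_indepFun [IsFiniteMeasure μ] [LinearOrder α] [TopologicalSpace α]
    [OrderClosedTopology α] [SecondCountableTopology α] [OpensMeasurableSpace α] {X Y : Ω → α}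
    (hX : Measurable X) (hY : Measurable Y) (h : IndepFun X Y μ) {H : α → ℝ≥0∞}
    (hH : Measurable H) :
    ∫⁻ ω in {ω | X ω < Y ω}, H (X ω) ∂μ = ∫⁻ ω, H (X ω) * μ.map Y (Ioi (X ω)) ∂μ := by
  have hF : Measurable (Function.uncurry fun x y => (Ioi x).indicator (fun _ => H x) y) :=
    (hH.comp measurable_fst).indicator (measurableSet_lt measurable_fst measurable_snd)
  rw [← lintegral_indicator (measurableSet_lt hX hY)]
  refine (lintegral_comp_prodMk_of_indepFun hX hY h hF).trans (lintegral_congr fun ω => ?_)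
  exact lintegral_indicator_const measurableSet_Ioi _

end Independence

lemma hasSum_measureReal_iUnion {ι Ω : Type*} [Countable ι] [MeasurableSpace Ω] {μ : Measure Ω}
    [IsFiniteMeasure μ] {A : ι → Set Ω} (hd : Pairwise (Function.onFun Disjoint A))
    (hA : ∀ i, MeasurableSet (A i)) : HasSum (fun i => μ.real (A i)) (μ.real (⋃ i, A i)) := by
  have hsum := measure_iUnion (μ := μ) hd hA
  rw [measureReal_def, hsum, ENNReal.tsum_toReal_eq fun i => measure_ne_top μ _]
  exact ENNReal.hasSum_toReal (hsum ▸ measure_ne_top μ _)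

lemma lintegral_le_one_of_le_one {Ω : Type*} [MeasurableSpace Ω] {μ : Measure Ω}
    [IsProbabilityMeasure μ] {f : Ω → ℝ≥0∞} (h : ∀ ω, f ω ≤ 1) : ∫⁻ ω, f ω ∂μ ≤ 1 :=
  (lintegral_mono h).trans (by simp)

lemma lintegral_one_sub {Ω : Type*} [MeasurableSpace Ω] {μ : Measure Ω}
    [IsProbabilityMeasure μ] {f : Ω → ℝ≥0∞} (hf : Measurable f)
    (h : ∀ ω, f ω ≤ 1) : ∫⁻ ω, (1 - f ω) ∂μ = 1 - ∫⁻ ω, f ω ∂μ := by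
  rw [lintegral_sub hf (ne_top_of_le_ne_top ENNReal.one_ne_top (lintegral_le_one_of_le_one h))
    (Eventually.of_forall h), lintegral_one, measure_univ]

lemma measurable_sInf_nat {α : Type*} [MeasurableSpace α] {p : ℕ → α → Prop}
    (hp : ∀ i, MeasurableSet {a | p i a}) : Measurable fun a => sInf {i | p i a} := by
  have hsInf (n : ℕ) (a : α) : sInf {i | p i a} ≤ n ↔ (∀ i, ¬ p i a) ∨ ∃ i ≤ n, p i a := by
    refine ⟨fun h => ?_, ?_⟩
    · by_contra! hne
      obtain ⟨⟨i, hi⟩, hlt⟩ := hne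
      exact hlt _ h (Nat.sInf_mem (s := {i | p i a}) ⟨i, hi⟩)
    · rintro (h | ⟨i, hin, hi⟩)
      · simp [h]
      · exact (Nat.sInf_le hi).trans hin
  refine measurable_of_Iic fun n => ?_
  simp only [Iic, preimage_ofPred_eq, hsInf, ofPred_or, ofPred_forall, ofPred_exists,
    ofPred_and]
  exact (MeasurableSet.iInter fun i => (hp i).compl).union
    (.iUnion fun i => (MeasurableSet.const _).inter (hp i))

section AvoidProd

/-- The probability that no index is kept, if the index `i` is kept with probability `g i`
independently of the others. It is the infimum of the partial products since these decrease. -/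
noncomputable def avoidProd (g : ℕ → ℝ≥0∞) : ℝ≥0∞ := ⨅ m, ∏ i ∈ Finset.range m, (1 - g i)

lemma antitone_prod_range_one_sub (g : ℕ → ℝ≥0∞) :
    Antitone fun m => ∏ i ∈ Finset.range m, (1 - g i) :=
  antitone_nat_of_succ_le fun m => by
    rw [Finset.prod_range_succ]
    exact mul_le_of_le_one_right' tsub_le_self

lemma tendsto_prod_range_one_sub (g : ℕ → ℝ≥0∞) :
    Tendsto (fun m => ∏ i ∈ Finset.range m, (1 - g i)) atTop (𝓝 (avoidProd g)) :=
  tendsto_atTop_iInf (antitone_prod_range_one_sub g)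

lemma prod_one_sub_le_one {ι : Type*} (s : Finset ι) (g : ι → ℝ≥0∞) : ∏ i ∈ s, (1 - g i) ≤ 1 :=
  Finset.prod_le_one' fun _ _ => tsub_le_self

lemma avoidProd_of_forall_eq_prod {κ : Type*} [Fintype κ] {g : ℕ → ℝ≥0∞} {a : κ → ℕ → ℝ≥0∞}
    (h : ∀ i, 1 - g i = ∏ b, (1 - a b i)) : avoidProd g = ∏ b, avoidProd (a b) := by
  refine tendsto_nhds_unique (tendsto_prod_range_one_sub g) ?_
  simp_rw [h, Finset.prod_comm (t := Finset.univ)]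
  exact ENNReal.tendsto_finsetProd_of_ne_top _ (fun b _ => tendsto_prod_range_one_sub (a b))
    fun b _ => ne_top_of_le_ne_top ENNReal.one_ne_top (iInf_le_of_le 0 (prod_one_sub_le_one _ _))

lemma avoidProd_indicator_of_finite {B : Set ℕ} (hB : B.Finite) (a : ℝ≥0∞) :
    avoidProd (B.indicator fun _ => a) = (1 - a) ^ B.encard.toNat := by
  classical
  refine tendsto_nhds_unique (tendsto_prod_range_one_sub _) (tendsto_const_nhds.congr' ?_)
  obtain ⟨M, hM⟩ := hB.bddAbove
  filter_upwards [eventually_gt_atTop M] with m hm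
  have hBm : B = (Finset.range m).filter (· ∈ B) := by
    ext i
    simpa using fun hi => (hM hi).trans_lt hm
  have hfac (i : ℕ) : 1 - B.indicator (fun _ => a) i = if i ∈ B then 1 - a else 1 := by
    by_cases hi : i ∈ B <;> simp [hi]
  simp_rw [hfac]
  rw [← Finset.prod_filter, Finset.prod_const]
  nth_rw 1 [hBm]
  rw [Set.encard_coe_eq_coe_finsetCard, ENat.toNat_natCast]

lemma avoidProd_indicator_of_infinite {B : Set ℕ} (hB : B.Infinite) {a : ℝ≥0∞} (ha : a ≠ 0) :
    avoidProd (B.indicator fun _ => a) = 0 := by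
  have h1 : 1 - a < 1 := ENNReal.sub_lt_self ENNReal.one_ne_top one_ne_zero ha
  refine le_antisymm (ge_of_tendsto' (ENNReal.tendsto_pow_atTop_nhds_zero_of_lt_one h1)
    fun N => ?_) zero_le
  obtain ⟨T, hT, hcard⟩ := hB.exists_subset_card_eq N
  have hsub : T ⊆ Finset.range (T.sup id + 1) := fun i hi =>
    Finset.mem_range.2 (Nat.lt_succ_of_le (Finset.le_sup (f := id) hi))
  calc avoidProd (B.indicator fun _ => a)
      ≤ ∏ i ∈ Finset.range (T.sup id + 1), (1 - B.indicator (fun _ => a) i) := iInf_le _ _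
    _ ≤ ∏ i ∈ T, (1 - B.indicator (fun _ => a) i) :=
        Finset.prod_le_prod_of_subset_of_le_one' hsub fun _ _ _ => tsub_le_self
    _ = (1 - a) ^ N := by
        rw [Finset.prod_congr rfl fun i hi => by rw [indicator_of_mem (hT hi)], Finset.prod_const,
          hcard]

lemma avoidProd_indicator_one (B : Set ℕ) [Decidable (∀ i, i ∉ B)] :
    avoidProd (B.indicator fun _ => 1) = if ∀ i, i ∉ B then 1 else 0 := by
  split_ifs with h
  · rw [eq_empty_of_forall_notMem h, avoidProd_indicator_of_finite finite_empty]
    simp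
  · obtain ⟨i, hi⟩ := not_forall_not.1 h
    obtain hB | hB := B.finite_or_infinite
    · have : B.encard.toNat ≠ 0 := by
        rw [← Set.ncard_def]
        exact Set.ncard_ne_zero_of_mem hi hB
      rw [avoidProd_indicator_of_finite hB, tsub_self, zero_pow this]
    · exact avoidProd_indicator_of_infinite hB one_ne_zero

variable {Ω : Type*} [MeasurableSpace Ω] {μ : Measure Ω} {g : Ω → ℕ → ℝ≥0∞}

lemma measurable_prod_one_sub {ι : Type*} (s : Finset ι) {g : Ω → ι → ℝ≥0∞}
    (hg : ∀ i, Measurable fun ω => g ω i) : Measurable fun ω => ∏ i ∈ s, (1 - g ω i) :=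
  Finset.measurable_fun_prod _ fun i _ => (hg i).const_sub 1

lemma measurable_avoidProd (hg : ∀ i, Measurable fun ω => g ω i) :
    Measurable fun ω => avoidProd (g ω) :=
  .iInf fun m => measurable_prod_one_sub (Finset.range m) hg

lemma lintegral_avoidProd [IsProbabilityMeasure μ] (hg : ∀ i, Measurable fun ω => g ω i) :
    ∫⁻ ω, avoidProd (g ω) ∂μ = ⨅ m, ∫⁻ ω, ∏ i ∈ Finset.range m, (1 - g ω i) ∂μ :=
  lintegral_iInf (fun m => measurable_prod_one_sub (Finset.range m) hg)
    (fun _ _ h ω => antitone_prod_range_one_sub (g ω) h)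
    (ne_top_of_le_ne_top ENNReal.one_ne_top
      (lintegral_le_one_of_le_one fun _ => prod_one_sub_le_one _ _))

lemma avoidProd_anti {g h : ℕ → ℝ≥0∞} (hgh : ∀ i, g i ≤ h i) : avoidProd h ≤ avoidProd g :=
  iInf_mono fun _ => Finset.prod_le_prod' fun i _ => tsub_le_tsub_left (hgh i) 1

lemma avoidProd_iSup {g : ℕ → ℕ → ℝ≥0∞} (hg : ∀ i, Monotone fun k => g k i) :
    avoidProd (fun i => ⨆ k, g k i) = ⨅ k, avoidProd (g k) := by
  have hanti (m : ℕ) : Antitone fun k => ∏ i ∈ Finset.range m, (1 - g k i) := fun _ _ h =>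
    Finset.prod_le_prod' fun i _ => tsub_le_tsub_left (hg i h) 1
  have hprod (m : ℕ) :
      ∏ i ∈ Finset.range m, (1 - ⨆ k, g k i) = ⨅ k, ∏ i ∈ Finset.range m, (1 - g k i) := by
    refine tendsto_nhds_unique ?_ (tendsto_atTop_iInf (hanti m))
    exact ENNReal.tendsto_finsetProd_of_ne_top _ (fun i _ => ENNReal.Tendsto.sub
      tendsto_const_nhds (tendsto_atTop_iSup (hg i)) (.inl ENNReal.one_ne_top))
      fun _ _ => ENNReal.sub_ne_top ENNReal.one_ne_top
  simp_rw [avoidProd, hprod]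
  exact iInf_comm

end AvoidProd

lemma lintegral_one_sub_pow_poissonMeasure (r : ℝ≥0) {a : ℝ≥0∞} (ha : a ≤ 1) :
    ∫⁻ n, (1 - a) ^ n ∂(poissonMeasure r) = ENNReal.ofReal (Real.exp (-(r * a.toReal))) := by
  lift 1 - a to ℝ≥0 using ENNReal.sub_ne_top ENNReal.one_ne_top with v hv
  have hva : (v : ℝ) = 1 - a.toReal := by
    rw [← ENNReal.coe_toReal, hv, ENNReal.toReal_sub_of_le ha ENNReal.one_ne_top,
      ENNReal.toReal_one]
  have hexp : Real.exp (-r) = Real.exp (-(r * a.toReal)) * Real.exp (-((r * v : ℝ≥0) : ℝ)) := by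
    rw [← Real.exp_add, NNReal.coe_mul, hva]
    ring_nf
  have hsum := (hasSum_one_poissonMeasure (r * v)).mul_left (Real.exp (-(r * a.toReal)))
  rw [mul_one] at hsum
  rw [poissonMeasure, lintegral_sum_measure, ← hsum.tsum_eq,
    ENNReal.ofReal_tsum_of_nonneg (fun n => by positivity) hsum.summable]
  refine tsum_congr fun n => ?_
  rw [lintegral_smul_measure, lintegral_dirac, smul_eq_mul, ← ENNReal.coe_pow,
    ← ENNReal.ofReal_coe_nnreal, ← ENNReal.ofReal_mul (by positivity), hexp]
  push_cast
  ring_nf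

lemma lintegral_prod_one_sub_of_iIndepFun {ι Ω F : Type*} [MeasurableSpace Ω] [MeasurableSpace F]
    {μ : Measure Ω} {Y : ι → Ω → F} (hY : ∀ i, Measurable (Y i)) (hind : iIndepFun Y μ)
    {g : ι → F → ℝ≥0∞} (hg : ∀ i, Measurable (g i)) (hle : ∀ i y, g i y ≤ 1) (s : Finset ι) :
    ∫⁻ ω, ∏ i ∈ s, (1 - g i (Y i ω)) ∂μ = ∏ i ∈ s, (1 - ∫⁻ y, g i y ∂(μ.map (Y i))) := by
  have := hind.isProbabilityMeasure
  have h := lintegral_prod_eq_prod_lintegral_of_indepFun s _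
    (hind.comp (fun i y => 1 - g i y) fun i => (hg i).const_sub 1)
    fun i => ((hg i).const_sub 1).comp (hY i)
  refine h.trans (Finset.prod_congr rfl fun i _ => ?_)
  rw [lintegral_map (hg i) (hY i)]
  exact lintegral_one_sub ((hg i).comp (hY i)) fun _ => hle i _

section PGFL

variable {Ω E F : Type*} [MeasurableSpace Ω] [MeasurableSpace E] [MeasurableSpace F]

/-- The points `X 0, X 1, …` have the probability generating functional of a Poisson process with
intensity measure `Λ`: if a point at `x` is kept with probability `h x` independently of the
others, then no point is kept with probability `exp (-∫ h dΛ)`. This is the form in which the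
Poisson property passes to marked processes. -/
structure HasPoissonPGFL (X : ℕ → Ω → E) (Λ : Measure E) (μ : Measure Ω) : Prop where
  measurable : ∀ i, Measurable (X i)
  lintegral_avoidProd : ∀ h : E → ℝ≥0∞, Measurable h → (∀ x, h x ≤ 1) → ∫⁻ x, h x ∂Λ ≠ ∞ →
    ∫⁻ ω, avoidProd (fun i => h (X i ω)) ∂μ = ENNReal.ofReal (Real.exp (-(∫⁻ x, h x ∂Λ).toReal))

variable {X : ℕ → Ω → E} {Λ : Measure E} {μ : Measure Ω}

namespace IsPoissonProcess

lemma measurable_encard (hX : IsPoissonProcess X Λ μ) {A : Set E} (hA : MeasurableSet A) :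
    Measurable fun ω => {i | X i ω ∈ A}.encard :=
  _root_.measurable_encard.comp (measurable_set_iff.2 fun i =>
    measurable_mem.2 (hX.measurable i hA))

variable [IsProbabilityMeasure μ]

section DisjointFamily

variable {k : ℕ} {A : Fin k → Set E}

lemma measure_forall_encard_eq (hX : IsPoissonProcess X Λ μ) (hA : ∀ b, MeasurableSet (A b))
    (hd : Pairwise fun b c => Disjoint (A b) (A c)) (hf : ∀ b, Λ (A b) ≠ ∞) (n : Fin k → ℕ) :
    μ {ω | ∀ b, {i | X i ω ∈ A b}.encard = (n b : ℕ∞)} =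
      Measure.pi (fun b => poissonMeasure (Λ (A b)).toNNReal) {n} := by
  rw [Measure.pi_singleton, ← ofReal_measureReal (measure_ne_top _ _), hX.count k A hA hd hf n,
    ENNReal.ofReal_prod_of_nonneg (fun b _ => by positivity)]
  exact Finset.prod_congr rfl fun b _ => (poissonMeasure_singleton _ _).symm

lemma ae_forall_finite (hX : IsPoissonProcess X Λ μ) (hA : ∀ b, MeasurableSet (A b))
    (hd : Pairwise fun b c => Disjoint (A b) (A c)) (hf : ∀ b, Λ (A b) ≠ ∞) :
    ∀ᵐ ω ∂μ, ∀ b, {i | X i ω ∈ A b}.Finite := by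
  let C (n : Fin k → ℕ) : Set Ω := {ω | ∀ b, {i | X i ω ∈ A b}.encard = (n b : ℕ∞)}
  have hC (n : Fin k → ℕ) : MeasurableSet (C n) := by
    simp only [C, ofPred_forall]
    exact .iInter fun b => hX.measurable_encard (hA b) (measurableSet_singleton _)
  have hCd : Pairwise (Function.onFun Disjoint C) := fun n n' hn =>
    Set.disjoint_left.2 fun ω h h' =>
      hn (funext fun b => by exact_mod_cast (h b).symm.trans (h' b))
  have hone : μ (⋃ n, C n) = 1 := by
    rw [measure_iUnion hCd hC]
    simp_rw [C, hX.measure_forall_encard_eq hA hd hf]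
    simpa using Measure.tsum_indicator_apply_singleton
      (Measure.pi fun b => poissonMeasure (Λ (A b)).toNNReal) univ .univ
  filter_upwards [(mem_ae_iff_prob_eq_one (.iUnion hC)).2 hone] with ω hω b
  obtain ⟨n, hn⟩ := mem_iUnion.1 hω
  exact finite_of_encard_eq_coe (hn b)

lemma map_encard (hX : IsPoissonProcess X Λ μ) (hA : ∀ b, MeasurableSet (A b))
    (hd : Pairwise fun b c => Disjoint (A b) (A c)) (hf : ∀ b, Λ (A b) ≠ ∞) :
    μ.map (fun ω b => {i | X i ω ∈ A b}.encard.toNat) =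
      Measure.pi (fun b => poissonMeasure (Λ (A b)).toNNReal) := by
  have hm : Measurable (fun ω b => {i | X i ω ∈ A b}.encard.toNat) :=
    measurable_pi_lambda _ fun b => Measurable.of_discrete.comp (hX.measurable_encard (hA b))
  refine Measure.ext_of_singleton fun n => ?_
  rw [← hX.measure_forall_encard_eq hA hd hf, Measure.map_apply hm (.of_discrete)]
  refine measure_congr ?_
  filter_upwards [hX.ae_forall_finite hA hd hf] with ω hω
  refine propext ⟨fun h b => ?_, fun h => funext fun b => ?_⟩
  · rw [← congrFun h b, ENat.natCast_toNat (encard_ne_top_iff.2 (hω b))]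
  · exact (congrArg ENat.toNat (h b)).trans (ENat.toNat_natCast _)

lemma lintegral_prod_one_sub_pow_encard (hX : IsPoissonProcess X Λ μ)
    (hA : ∀ b, MeasurableSet (A b)) (hd : Pairwise fun b c => Disjoint (A b) (A c))
    (hf : ∀ b, Λ (A b) ≠ ∞) {a : Fin k → ℝ≥0∞} (ha : ∀ b, a b ≤ 1) :
    ∫⁻ ω, ∏ b, (1 - a b) ^ {i | X i ω ∈ A b}.encard.toNat ∂μ =
      ENNReal.ofReal (Real.exp (-(∑ b, a b * Λ (A b)).toReal)) := by
  have hm : Measurable (fun ω b => {i | X i ω ∈ A b}.encard.toNat) :=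
    measurable_pi_lambda _ fun b => Measurable.of_discrete.comp (hX.measurable_encard (hA b))
  have hind : iIndepFun (fun (b : Fin k) (n : Fin k → ℕ) => (1 - a b) ^ n b)
      (Measure.pi fun b => poissonMeasure (Λ (A b)).toNNReal) :=
    iIndepFun_pi (X := fun b n => (1 - a b) ^ n) fun b => Measurable.of_discrete.aemeasurable
  calc ∫⁻ ω, ∏ b, (1 - a b) ^ {i | X i ω ∈ A b}.encard.toNat ∂μ
      = ∫⁻ n, ∏ b, (1 - a b) ^ n b ∂(Measure.pi fun b => poissonMeasure (Λ (A b)).toNNReal) := by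
        rw [← hX.map_encard hA hd hf, lintegral_map .of_discrete hm]
    _ = ∏ b, ∫⁻ n, (1 - a b) ^ n ∂(poissonMeasure (Λ (A b)).toNNReal) := by
        rw [lintegral_prod_eq_prod_lintegral_of_indepFun _ _ hind fun b => .of_discrete]
        refine Finset.prod_congr rfl fun b _ => ?_
        rw [← lintegral_map (f := fun n : ℕ => (1 - a b) ^ n) .of_discrete
          (measurable_pi_apply b), Measure.pi_map_eval]
        simp
    _ = ENNReal.ofReal (Real.exp (-(∑ b, a b * Λ (A b)).toReal)) := by
        rw [ENNReal.toReal_sum fun b _ =>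
          ENNReal.mul_ne_top (ne_top_of_le_ne_top ENNReal.one_ne_top (ha b)) (hf b),
          ← Finset.sum_neg_distrib, Real.exp_sum,
          ENNReal.ofReal_prod_of_nonneg fun b _ => by positivity]
        refine Finset.prod_congr rfl fun b _ => ?_
        rw [lintegral_one_sub_pow_poissonMeasure _ (ha b), ENNReal.toReal_mul, mul_comm]
        rfl

lemma lintegral_avoidProd_sum_indicator (hX : IsPoissonProcess X Λ μ)
    (hA : ∀ b, MeasurableSet (A b)) (hd : Pairwise fun b c => Disjoint (A b) (A c))
    (hf : ∀ b, Λ (A b) ≠ ∞) {a : Fin k → ℝ≥0∞} (ha : ∀ b, a b ≤ 1) :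
    ∫⁻ ω, avoidProd (fun i => ∑ b, (A b).indicator (fun _ => a b) (X i ω)) ∂μ =
      ENNReal.ofReal (Real.exp (-(∑ b, a b * Λ (A b)).toReal)) := by
  have hfac (x : E) : 1 - ∑ b, (A b).indicator (fun _ => a b) x =
      ∏ b, (1 - (A b).indicator (fun _ => a b) x) := by
    by_cases hx : ∃ b, x ∈ A b
    · obtain ⟨b, hb⟩ := hx
      have hne (c : Fin k) (hc : c ≠ b) : (A c).indicator (fun _ => a c) x = 0 :=
        indicator_of_notMem ((hd hc).notMem_of_mem_right hb) _
      rw [Finset.sum_eq_single b (fun c _ => hne c) (by simp),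
        Finset.prod_eq_single b (fun c _ hc => by rw [hne c hc, tsub_zero]) (by simp)]
    · have h0 (b : Fin k) : (A b).indicator (fun _ => a b) x = 0 :=
        indicator_of_notMem (not_exists.1 hx b) _
      simp only [h0, Finset.sum_const_zero, tsub_zero, Finset.prod_const_one]
  rw [← hX.lintegral_prod_one_sub_pow_encard hA hd hf ha]
  refine lintegral_congr_ae ?_
  filter_upwards [hX.ae_forall_finite hA hd hf] with ω hω
  rw [avoidProd_of_forall_eq_prod fun i => hfac (X i ω)]
  exact Finset.prod_congr rfl fun b _ => avoidProd_indicator_of_finite (hω b) (a b)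

end DisjointFamily

lemma lintegral_avoidProd_simpleFunc (hX : IsPoissonProcess X Λ μ) (g : SimpleFunc E ℝ≥0∞)
    (hg : ∀ x, g x ≤ 1) (hfin : ∫⁻ x, g x ∂Λ ≠ ∞) :
    ∫⁻ ω, avoidProd (fun i => g (X i ω)) ∂μ =
      ENNReal.ofReal (Real.exp (-(∫⁻ x, g x ∂Λ).toReal)) := by
  classical
  let S := g.range.filter (· ≠ 0)
  let e := S.equivFin.symm
  let a (b : Fin S.card) : ℝ≥0∞ := e b
  let A (b : Fin S.card) : Set E := g ⁻¹' {a b}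
  have ha (b) : a b ≤ 1 := by
    obtain ⟨x, hx⟩ := SimpleFunc.mem_range.1 (Finset.mem_filter.1 (e b).2).1
    exact hx.symm.trans_le (hg x)
  have hd : Pairwise fun b c => Disjoint (A b) (A c) := fun b c hbc =>
    Disjoint.preimage g (disjoint_singleton.2 fun h => hbc (e.injective (Subtype.ext h)))
  have hgA (x : E) : g x = ∑ b, (A b).indicator (fun _ => a b) x := by
    have : ∑ b, (A b).indicator (fun _ => a b) x = ∑ c ∈ S, if g x = c then c else 0 := by
      rw [← Finset.sum_coe_sort S fun c => if g x = c then c else 0, ← e.sum_comp]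
      simp only [indicator_apply, A, a, mem_preimage, mem_singleton_iff]
    simp [this, S]
  have hint : ∫⁻ x, g x ∂Λ = ∑ b, a b * Λ (A b) := by
    simp_rw [hgA]
    rw [lintegral_finsetSum _ fun b _ => measurable_const.indicator (g.measurableSet_fiber _)]
    simp_rw [lintegral_indicator_const (g.measurableSet_fiber _), A]
  have hf (b) : Λ (A b) ≠ ∞ := fun hb => hfin <| hint ▸ ENNReal.sum_eq_top.2
    ⟨b, Finset.mem_univ _, by rw [hb, ENNReal.mul_top (Finset.mem_filter.1 (e b).2).2]⟩
  simp_rw [hgA (X _ _)]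
  rw [hint]
  exact hX.lintegral_avoidProd_sum_indicator (fun b => g.measurableSet_fiber _) hd hf ha

theorem hasPoissonPGFL (hX : IsPoissonProcess X Λ μ) : HasPoissonPGFL X Λ μ := by
  refine ⟨hX.measurable, fun h hm hle hfin => ?_⟩
  let g (k : ℕ) : SimpleFunc E ℝ≥0∞ := SimpleFunc.eapprox h k
  have hg (x : E) : ⨆ k, g k x = h x := SimpleFunc.iSup_eapprox_apply hm x
  have hmono (x : E) : Monotone fun k => g k x := fun _ _ hk => SimpleFunc.monotone_eapprox h hk x
  have hgh (k : ℕ) (x : E) : g k x ≤ h x := hg x ▸ le_iSup (fun k => g k x) k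
  have hgfin (k : ℕ) : ∫⁻ x, g k x ∂Λ ≠ ∞ := ne_top_of_le_ne_top hfin (lintegral_mono (hgh k))
  have hint : ∫⁻ x, h x ∂Λ = ⨆ k, ∫⁻ x, g k x ∂Λ := by
    simp_rw [← hg]
    exact lintegral_iSup (fun k => (g k).measurable) fun _ _ hk x => hmono x hk
  have hlhs : ∫⁻ ω, avoidProd (fun i => h (X i ω)) ∂μ =
      ⨅ k, ∫⁻ ω, avoidProd (fun i => g k (X i ω)) ∂μ := by
    simp_rw [← hg, avoidProd_iSup fun _ => hmono _]
    exact lintegral_iInf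
      (fun k => measurable_avoidProd fun i => (g k).measurable.comp (hX.measurable i))
      (fun _ _ hk ω => avoidProd_anti fun i => hmono _ hk)
      (ne_top_of_le_ne_top ENNReal.one_ne_top
        (lintegral_le_one_of_le_one fun _ => iInf_le_of_le 0 (prod_one_sub_le_one _ _)))
  simp_rw [hlhs,
    fun k => hX.lintegral_avoidProd_simpleFunc (g k) (fun x => (hgh k x).trans (hle x)) (hgfin k)]
  refine tendsto_nhds_unique (tendsto_atTop_iInf fun k l hkl => ?_) ?_
  · have := ENNReal.toReal_mono (hgfin l) (lintegral_mono (μ := Λ) fun x => hmono x hkl)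
    gcongr
  · have hlim : Tendsto (fun k => ∫⁻ x, g k x ∂Λ) atTop (𝓝 (∫⁻ x, h x ∂Λ)) :=
      hint ▸ tendsto_atTop_iSup fun k l hkl => lintegral_mono fun x => hmono x hkl
    exact ENNReal.tendsto_ofReal ((Real.continuous_exp.tendsto _).comp
      ((ENNReal.tendsto_toReal hfin).comp hlim).neg)

end IsPoissonProcess

namespace HasPoissonPGFL

theorem prodMk [IsProbabilityMeasure μ] (hX : HasPoissonPGFL X Λ μ) {Y : ℕ → Ω → F} {ν : Measure F}
    (hY : ∀ i, Measurable (Y i)) (hlaw : ∀ i, μ.map (Y i) = ν) (hind : iIndepFun Y μ)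
    (hXY : IndepFun (fun ω i => X i ω) (fun ω i => Y i ω) μ) :
    HasPoissonPGFL (fun i ω => (X i ω, Y i ω)) (Λ.prod ν) μ := by
  refine ⟨fun i => (hX.measurable i).prodMk (hY i), fun h hm hle hfin => ?_⟩
  have : IsProbabilityMeasure ν := hlaw 0 ▸ Measure.isProbabilityMeasure_map (hY 0).aemeasurable
  let H (x : E) : ℝ≥0∞ := ∫⁻ y, h (x, y) ∂ν
  have hH : ∫⁻ z, h z ∂(Λ.prod ν) = ∫⁻ x, H x ∂Λ := lintegral_prod _ hm.aemeasurable
  have hmx (x : E) : Measurable fun y => h (x, y) := hm.comp measurable_prodMk_left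
  have hmarks (m : ℕ) (x : ℕ → E) : ∫⁻ y, ∏ i ∈ Finset.range m, (1 - h (x i, y i))
      ∂(μ.map fun ω i => Y i ω) = ∏ i ∈ Finset.range m, (1 - H (x i)) := by
    rw [lintegral_map (measurable_prod_one_sub (g := fun (y : ℕ → F) i => h (x i, y i)) _
      fun i => (hmx _).comp (measurable_pi_apply i)) (measurable_pi_iff.2 hY),
      lintegral_prod_one_sub_of_iIndepFun hY hind (fun i => hmx (x i)) fun _ _ => hle _]
    simp_rw [hlaw]
    rfl
  have hpartial (m : ℕ) : ∫⁻ ω, ∏ i ∈ Finset.range m, (1 - h (X i ω, Y i ω)) ∂μ =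
      ∫⁻ ω, ∏ i ∈ Finset.range m, (1 - H (X i ω)) ∂μ := by
    simp_rw [← hmarks]
    exact lintegral_comp_prodMk_of_indepFun
      (F := fun x y => ∏ i ∈ Finset.range m, (1 - h (x i, y i)))
      (measurable_pi_iff.2 hX.measurable) (measurable_pi_iff.2 hY) hXY
      (measurable_prod_one_sub (g := fun (z : (ℕ → E) × (ℕ → F)) i => h (z.1 i, z.2 i)) _
        fun i => by fun_prop)
  rw [MmWave.lintegral_avoidProd (g := fun ω i => h (X i ω, Y i ω))
    fun i => hm.comp ((hX.measurable i).prodMk (hY i)), hH,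
    ← hX.lintegral_avoidProd H hm.lintegral_prod_right' (fun x => lintegral_le_one_of_le_one
      fun y => hle (x, y)) (hH ▸ hfin),
    MmWave.lintegral_avoidProd (g := fun ω i => H (X i ω)) fun i =>
      hm.lintegral_prod_right'.comp (hX.measurable i)]
  simp_rw [hpartial]

lemma map_pi (hX : HasPoissonPGFL X Λ μ) :
    HasPoissonPGFL (fun i x => x i) Λ (μ.map fun ω i => X i ω) := by
  refine ⟨fun i => measurable_pi_apply i, fun h hm hle hfin => ?_⟩
  have havoid : Measurable fun x : ℕ → E => avoidProd fun i => h (x i) :=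
    measurable_avoidProd fun i => hm.comp (measurable_pi_apply i)
  exact (lintegral_map havoid (measurable_pi_iff.2 hX.measurable)).trans
    (hX.lintegral_avoidProd h hm hle hfin)

variable {A : Set E}

lemma lintegral_avoidProd_indicator (hX : HasPoissonPGFL X Λ μ) (hA : MeasurableSet A)
    (hf : Λ A ≠ ∞) {a : ℝ≥0∞} (ha : a ≤ 1) :
    ∫⁻ ω, avoidProd ({i | X i ω ∈ A}.indicator fun _ => a) ∂μ =
      ENNReal.ofReal (Real.exp (-(a * Λ A).toReal)) := by
  have hint : ∫⁻ x, A.indicator (fun _ => a) x ∂Λ = a * Λ A := lintegral_indicator_const hA a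
  rw [← hint]
  exact hX.lintegral_avoidProd _ (measurable_const.indicator hA)
    (indicator_le' (fun _ _ => ha) fun _ _ => zero_le_one)
    (hint ▸ ENNReal.mul_ne_top (ne_top_of_le_ne_top ENNReal.one_ne_top ha) hf)

lemma measure_forall_notMem (hX : HasPoissonPGFL X Λ μ) (hA : MeasurableSet A) (hf : Λ A ≠ ∞) :
    μ {ω | ∀ i, X i ω ∉ A} = ENNReal.ofReal (Real.exp (-(Λ A).toReal)) := by
  classical
  have hm : MeasurableSet {ω | ∀ i, X i ω ∉ A} := by
    simp only [ofPred_forall]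
    exact .iInter fun i => hX.measurable i hA.compl
  have h := hX.lintegral_avoidProd_indicator hA hf le_rfl
  simp_rw [avoidProd_indicator_one, one_mul] at h
  rw [← h, ← lintegral_indicator_one hm]
  exact lintegral_congr fun ω => by simp [indicator_apply]

-- Keeping the points of `A` with probability `ε` avoids them all with probability zero if there
-- are infinitely many, and with probability `exp (-ε Λ A) → 1` on average as `ε → 0`.
lemma ae_finite_setOf_mem [IsProbabilityMeasure μ] (hX : HasPoissonPGFL X Λ μ)
    (hA : MeasurableSet A) (hf : Λ A ≠ ∞) :
    ∀ᵐ ω ∂μ, {i | X i ω ∈ A}.Finite := by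
  have hm : MeasurableSet {ω | {i | X i ω ∈ A}.Finite} := by
    have h : Measurable fun ω => {i | X i ω ∈ A}.encard := _root_.measurable_encard.comp
      (measurable_set_iff.2 fun i => measurable_mem.2 (hX.measurable i hA))
    simpa only [preimage_ofPred_eq, compl_def, mem_preimage, mem_singleton_iff, encard_ne_top_iff]
      using h (measurableSet_singleton ⊤).compl
  have hle (n : ℕ) : ENNReal.ofReal (Real.exp (-(((n : ℝ≥0∞) + 1)⁻¹ * Λ A).toReal)) ≤
      μ {ω | {i | X i ω ∈ A}.Finite} := by
    rw [← hX.lintegral_avoidProd_indicator hA hf (ENNReal.inv_le_one.2 le_add_self),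
      ← lintegral_indicator_one hm]
    refine lintegral_mono fun ω => ?_
    by_cases h : {i | X i ω ∈ A}.Finite
    · exact (iInf_le_of_le 0 (prod_one_sub_le_one _ _)).trans_eq (by simp [h])
    · exact (avoidProd_indicator_of_infinite h
        (ENNReal.inv_ne_zero.2 (by finiteness))).trans_le zero_le
  have hlim : Tendsto (fun n : ℕ => ENNReal.ofReal
      (Real.exp (-(((n : ℝ≥0∞) + 1)⁻¹ * Λ A).toReal))) atTop (𝓝 1) := by
    have hinv : Tendsto (fun n : ℕ => ((n : ℝ≥0∞) + 1)⁻¹) atTop (𝓝 0) := by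
      exact_mod_cast (tendsto_add_atTop_iff_nat 1).2 ENNReal.tendsto_inv_nat_nhds_zero
    have hmul := (ENNReal.tendsto_toReal (by simp)).comp
      (ENNReal.Tendsto.mul_const hinv (.inr hf))
    simpa using ENNReal.tendsto_ofReal ((Real.continuous_exp.tendsto _).comp hmul.neg)
  exact (mem_ae_iff_prob_eq_one hm).2 (le_antisymm prob_le_one (le_of_tendsto' hlim hle))

end HasPoissonPGFL

end PGFL

section GaussianTail

lemma Q_eq_one_sub_cdf (x : ℝ) : Q x = 1 - cdf (gaussianReal 0 1) x := by
  rw [Q, cdf_eq_real, ← compl_Iic, probReal_compl_eq_one_sub measurableSet_Iic]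

lemma Q_nonneg (x : ℝ) : 0 ≤ Q x := measureReal_nonneg

lemma Q_le_one (x : ℝ) : Q x ≤ 1 := measureReal_le_one

lemma tendsto_Q_atTop : Tendsto Q atTop (𝓝 0) := by
  rw [funext Q_eq_one_sub_cdf]
  simpa using (tendsto_cdf_atTop (gaussianReal 0 1)).const_sub 1

lemma hasDerivAt_Q (x : ℝ) : HasDerivAt Q (-gaussianPDFReal 0 1 x) x := by
  have hint := integrable_gaussianPDFReal 0 1
  have hc : Continuous (gaussianPDFReal 0 1) := by unfold gaussianPDFReal; fun_prop
  have hQ (y : ℝ) : Q y = 1 - ∫ z in Iic y, gaussianPDFReal 0 1 z := by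
    rw [Q_eq_one_sub_cdf, cdf_eq_real, measureReal_def,
      gaussianReal_apply_eq_integral 0 one_ne_zero,
      ENNReal.toReal_ofReal (integral_nonneg fun _ => gaussianPDFReal_nonneg _ _ _)]
  have hQ' (y : ℝ) : Q y = Q 0 - ∫ z in (0 : ℝ)..y, gaussianPDFReal 0 1 z := by
    rw [hQ y, hQ 0, ← intervalIntegral.integral_Iic_sub_Iic hint.integrableOn hint.integrableOn]
    ring
  rw [funext hQ']
  exact (intervalIntegral.integral_hasDerivAt_right hint.intervalIntegrable
    (hc.stronglyMeasurableAtFilter _ _) hc.continuousAt).const_sub _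

lemma gaussianReal_Ioi (y : ℝ) : gaussianReal 0 1 (Ioi y) = ENNReal.ofReal (Q y) :=
  (ofReal_measureReal (measure_ne_top _ _)).symm

lemma gaussianReal_Iic (y : ℝ) : gaussianReal 0 1 (Iic y) = ENNReal.ofReal (Q (-y)) := by
  have hneg : (gaussianReal 0 1).map (fun x => -x) = gaussianReal 0 1 := by
    rw [gaussianReal_map_neg, neg_zero]
  have := nullSingletonClass_gaussianReal (μ := 0) (v := 1) one_ne_zero
  rw [← gaussianReal_Ioi, ← Iio_ae_eq_Iic.measure_eq]
  conv_lhs => rw [← hneg, Measure.map_apply measurable_neg measurableSet_Iio]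
  congr 1
  ext x
  simp

lemma setLIntegral_exp_mul_gaussianReal (a : ℝ) {s : Set ℝ} (hs : MeasurableSet s) :
    ∫⁻ w in s, ENNReal.ofReal (Real.exp (a * w)) ∂(gaussianReal 0 1) =
      ENNReal.ofReal (Real.exp (a ^ 2 / 2)) * gaussianReal a 1 s := by
  have hpdf (w : ℝ) : gaussianPDFReal 0 1 w * Real.exp (a * w) =
      Real.exp (a ^ 2 / 2) * gaussianPDFReal a 1 w := by
    simp only [gaussianPDFReal]
    rw [mul_assoc, ← Real.exp_add, mul_left_comm, ← Real.exp_add]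
    congr 2
    push_cast
    ring
  rw [gaussianReal_apply a one_ne_zero, gaussianReal_of_var_ne_zero 0 one_ne_zero,
    setLIntegral_withDensity_eq_setLIntegral_mul _ (measurable_gaussianPDF _ _) (by fun_prop) hs,
    ← lintegral_const_mul _ (measurable_gaussianPDF _ _)]
  refine lintegral_congr fun w => ?_
  simp only [Pi.mul_apply, gaussianPDF_def]
  rw [← ENNReal.ofReal_mul (gaussianPDFReal_nonneg _ _ _), ← ENNReal.ofReal_mul (by positivity),
    hpdf]

lemma lintegral_exp_mul_gaussianReal (a : ℝ) :
    ∫⁻ w, ENNReal.ofReal (Real.exp (a * w)) ∂(gaussianReal 0 1) =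
      ENNReal.ofReal (Real.exp (a ^ 2 / 2)) := by
  rw [← setLIntegral_univ, setLIntegral_exp_mul_gaussianReal a .univ, measure_univ, mul_one]

lemma setLIntegral_Iic_exp_mul_gaussianReal (a u : ℝ) :
    ∫⁻ w in Iic u, ENNReal.ofReal (Real.exp (a * w)) ∂(gaussianReal 0 1) =
      ENNReal.ofReal (Real.exp (a ^ 2 / 2) * Q (a - u)) := by
  have hshift : (gaussianReal 0 1).map (· + a) = gaussianReal a 1 := by
    rw [gaussianReal_map_add_const, zero_add]
  rw [setLIntegral_exp_mul_gaussianReal a measurableSet_Iic, ENNReal.ofReal_mul (by positivity),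
    ← neg_sub u a, ← gaussianReal_Iic, ← hshift,
    Measure.map_apply (measurable_add_const a) measurableSet_Iic, preimage_add_const_Iic]

end GaussianTail

/-- The plane that contains the base stations; the typical user is at `0`. -/
abbrev Plane := EuclideanSpace ℝ (Fin 2)

/-- A link to the typical user: the position of its base station, the two candidate shadowings (of
which only the one of the type of the link counts), and whether the link is unblocked. -/
abbrev Link := (Plane × (LinkType → ℝ)) × Bool

instance : MeasurableSpace LinkType := ⊤

instance : DiscreteMeasurableSpace LinkType := ⟨fun _ => trivial⟩

instance : Fintype LinkType :=
  ⟨⟨[LinkType.los, LinkType.nlos], by simp⟩, fun j => by cases j <;> simp⟩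

namespace Params

variable (P : Params)

section PathLoss

lemma σ_pos (j : LinkType) : 0 < P.σ j := by
  have := P.ξ_pos j
  have : 0 < Real.log 10 := Real.log_pos (by norm_num)
  unfold σ
  positivity

lemma pathLoss_pos (j : LinkType) (r s : ℝ) : 0 < P.pathLoss j r s :=
  Real.rpow_pos_of_pos (by norm_num) _

@[fun_prop]
lemma measurable_pathLoss {α : Type*} [MeasurableSpace α] (j : LinkType) {r s : α → ℝ}
    (hr : Measurable r) (hs : Measurable s) : Measurable fun a => P.pathLoss j (r a) (s a) := by
  unfold pathLoss Real.logb
  fun_prop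

/-- The distance up to which a link of type `j` with shadowing `-ξ_j w` has path loss at most
`t`. -/
noncomputable def reach (j : LinkType) (t w : ℝ) : ℝ :=
  Real.exp ((Real.log t + P.m + P.σ j * w) / P.α j)

lemma reach_pos (j : LinkType) (t w : ℝ) : 0 < P.reach j t w := Real.exp_pos _

lemma pathLoss_le_iff {j : LinkType} {t r w : ℝ} (ht : 0 < t) (hr : 0 < r) :
    P.pathLoss j r (-(P.ξ j * w)) ≤ t ↔ r ≤ P.reach j t w := by
  have hα := P.α_pos j
  have hlog : Real.log t - (P.β + 10 * P.α j * (Real.log r / Real.log 10) + -(P.ξ j * w)) / 10 *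
      Real.log 10 = Real.log t + -(0.1 * P.β * Real.log 10) + 0.1 * P.ξ j * Real.log 10 * w -
      Real.log r * P.α j := by
    have := Real.log_pos (show (1 : ℝ) < 10 by norm_num)
    field_simp
    ring
  rw [← Real.log_le_log_iff (P.pathLoss_pos _ _ _) ht, reach, ← Real.log_le_iff_le_exp hr,
    le_div_iff₀ hα, pathLoss, Real.log_rpow (by norm_num), m, σ, Real.logb, ← sub_nonneg, hlog,
    sub_nonneg]

lemma reach_sq {j : LinkType} {t w : ℝ} (ht : 0 < t) :
    P.reach j t w ^ 2 = t ^ (2 / P.α j) * Real.exp (2 * P.m / P.α j) *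
      Real.exp (2 * P.σ j / P.α j * w) := by
  rw [reach, Real.rpow_def_of_pos ht, ← Real.exp_add, ← Real.exp_add, ← Real.exp_nat_mul]
  congr 1
  push_cast
  ring

lemma reach_le_D_iff {j : LinkType} {t w : ℝ} (ht : 0 < t) :
    P.reach j t w ≤ P.D ↔ w ≤ P.Upsilon j t := by
  have hα := P.α_pos j
  have hD := P.D_pos
  rw [reach, ← Real.le_log_iff_exp_le hD, div_le_iff₀ hα, Upsilon, le_div_iff₀ (P.σ_pos j),
    Real.log_div (by positivity) ht.ne', Real.log_rpow hD]
  constructor <;> intro h <;> linarith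

lemma volume_pathLoss_le {j : LinkType} {t : ℝ} (ht : 0 < t) (w : ℝ) :
    volume {x : Plane | P.pathLoss j ‖x‖ (-(P.ξ j * w)) ≤ t} =
      ENNReal.ofReal (Real.pi * P.reach j t w ^ 2) := by
  have hball : {x : Plane | P.pathLoss j ‖x‖ (-(P.ξ j * w)) ≤ t} =ᵐ[volume]
      Metric.closedBall (0 : Plane) (P.reach j t w) := by
    filter_upwards [Measure.ae_ne volume (0 : Plane)] with x hx
    exact propext ((P.pathLoss_le_iff ht (norm_pos_iff.2 hx)).trans mem_closedBall_zero_iff.symm)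
  rw [measure_congr hball, EuclideanSpace.volume_closedBall_fin_two, mul_comm Real.pi,
    ENNReal.ofReal_mul (by positivity), ENNReal.ofReal_pow (P.reach_pos j t w).le]

lemma volume_norm_le_D_and_pathLoss_le {j : LinkType} {t : ℝ} (ht : 0 < t) (w : ℝ) :
    volume {x : Plane | ‖x‖ ≤ P.D ∧ P.pathLoss j ‖x‖ (-(P.ξ j * w)) ≤ t} =
      ENNReal.ofReal (Real.pi * min P.D (P.reach j t w) ^ 2) := by
  have hball : {x : Plane | ‖x‖ ≤ P.D ∧ P.pathLoss j ‖x‖ (-(P.ξ j * w)) ≤ t} =ᵐ[volume]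
      Metric.closedBall (0 : Plane) (min P.D (P.reach j t w)) := by
    filter_upwards [Measure.ae_ne volume (0 : Plane)] with x hx
    refine propext (Iff.trans ?_ (mem_closedBall_zero_iff.trans le_min_iff).symm)
    exact and_congr_right' (P.pathLoss_le_iff ht (norm_pos_iff.2 hx))
  rw [measure_congr hball, EuclideanSpace.volume_closedBall_fin_two, mul_comm Real.pi,
    ENNReal.ofReal_mul (by positivity),
    ENNReal.ofReal_pow (le_min P.D_pos.le (P.reach_pos j t w).le)]

end PathLoss

section LinkIntensity

/-- Law of the shadowing (in dB) on links of type `j`. -/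
noncomputable def shadowLaw (j : LinkType) : Measure ℝ :=
  gaussianReal 0 (Real.toNNReal (P.ξ j ^ 2))

instance (j : LinkType) : IsProbabilityMeasure (P.shadowLaw j) := by
  unfold shadowLaw; infer_instance

/-- Law of the indicator that a link is unblocked. -/
noncomputable def unblockedLaw : Measure Bool :=
  bernoulliMeasure true false ⟨P.pLOS, P.pLOS_nonneg, P.pLOS_le_one⟩

instance : IsProbabilityMeasure P.unblockedLaw := by unfold unblockedLaw; infer_instance

lemma unblockedLaw_true : P.unblockedLaw {true} = ENNReal.ofReal P.pLOS := by
  rw [unblockedLaw, bernoulliMeasure_apply_of_mem_of_notMem _ (by simp) (by simp) (by simp),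
    ENNReal.ofReal, Real.toNNReal_of_nonneg P.pLOS_nonneg]
  rfl

/-- Intensity measure of the Poisson process of links. -/
noncomputable def linkIntensity : Measure Link :=
  ((ENNReal.ofReal P.lamBS • (volume : Measure Plane)).prod (Measure.infinitePi P.shadowLaw)).prod
    P.unblockedLaw

/-- `e_j(t)` of the informal statement: for base stations of unit density, all of whose links have
type `j`, the mean number of links with path loss at most `t` is `π * scale j t`. -/
noncomputable def scale (j : LinkType) (t : ℝ) : ℝ :=
  t ^ (2 / P.α j) * Real.exp (2 * P.σ j ^ 2 / P.α j ^ 2 + 2 * P.m / P.α j)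

/-- For base stations of unit density, all of whose links have type `j`, the mean number of links
of length at most `D` and path loss at most `t`. -/
noncomputable def discMean (j : LinkType) (t : ℝ) : ℝ :=
  Real.pi * (P.D ^ 2 * Q (P.Upsilon j t) +
    P.scale j t * Q (2 * P.σ j ^ 2 / (P.α j * P.σ j) - P.Upsilon j t))

lemma M_los (t : ℝ) : P.M .los t = P.pLOS * P.discMean .los t := by
  simp only [M, discMean, scale]
  ring

lemma M_nlos (t : ℝ) :
    P.M .nlos t = Real.pi * P.scale .nlos t - P.pLOS * P.discMean .nlos t := by
  simp only [M, discMean, scale]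
  ring

lemma scale_nonneg (j : LinkType) {t : ℝ} (ht : 0 ≤ t) : 0 ≤ P.scale j t := by
  unfold scale; positivity

lemma discMean_nonneg (j : LinkType) {t : ℝ} (ht : 0 ≤ t) : 0 ≤ P.discMean j t := by
  have := P.scale_nonneg j ht
  have := Q_nonneg (P.Upsilon j t)
  have := Q_nonneg (2 * P.σ j ^ 2 / (P.α j * P.σ j) - P.Upsilon j t)
  unfold discMean
  positivity

lemma map_gaussianReal_eq_shadowLaw (j : LinkType) :
    (gaussianReal 0 1).map (fun w => -(P.ξ j * w)) = P.shadowLaw j := by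
  simp_rw [← neg_mul]
  rw [gaussianReal_map_const_mul, shadowLaw, mul_zero, mul_one]
  congr 1
  ext
  simp [Real.coe_toNNReal _ (sq_nonneg _)]

lemma prod_shadowLaw_apply (j : LinkType) {A : Set (Plane × ℝ)} (hA : MeasurableSet A) :
    (volume.prod (P.shadowLaw j)) A =
      ∫⁻ w, volume {x : Plane | (x, -(P.ξ j * w)) ∈ A} ∂(gaussianReal 0 1) := by
  rw [Measure.prod_apply_symm hA, ← P.map_gaussianReal_eq_shadowLaw j,
    lintegral_map (measurable_measure_prodMk_right hA) (by fun_prop)]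
  rfl

lemma prod_shadowLaw_pathLoss_le (j : LinkType) {t : ℝ} (ht : 0 < t) :
    (volume.prod (P.shadowLaw j)) {z : Plane × ℝ | P.pathLoss j ‖z.1‖ z.2 ≤ t} =
      ENNReal.ofReal (Real.pi * P.scale j t) := by
  have hreach (w : ℝ) : ENNReal.ofReal (Real.pi * P.reach j t w ^ 2) =
      ENNReal.ofReal (Real.pi * (t ^ (2 / P.α j) * Real.exp (2 * P.m / P.α j))) *
        ENNReal.ofReal (Real.exp (2 * P.σ j / P.α j * w)) := by
    rw [P.reach_sq ht, ← ENNReal.ofReal_mul (by positivity), mul_assoc Real.pi]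
  rw [P.prod_shadowLaw_apply j (measurableSet_le (by fun_prop) measurable_const)]
  simp only [mem_ofPred_eq, P.volume_pathLoss_le ht, hreach]
  rw [lintegral_const_mul _ (by fun_prop), lintegral_exp_mul_gaussianReal,
    ← ENNReal.ofReal_mul (by positivity), scale, mul_assoc, mul_assoc, ← Real.exp_add]
  ring_nf

lemma lintegral_min_D_reach (j : LinkType) {t : ℝ} (ht : 0 < t) :
    ∫⁻ w, ENNReal.ofReal (Real.pi * min P.D (P.reach j t w) ^ 2) ∂(gaussianReal 0 1) =
      ENNReal.ofReal (P.discMean j t) := by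
  have hσ := P.σ_pos j
  have hα := P.α_pos j
  have hQ1 := Q_nonneg (P.Upsilon j t)
  have hQ2 := Q_nonneg (2 * P.σ j / P.α j - P.Upsilon j t)
  have hnear : ∫⁻ w in Iic (P.Upsilon j t), ENNReal.ofReal (Real.pi *
      min P.D (P.reach j t w) ^ 2) ∂(gaussianReal 0 1) =
      ENNReal.ofReal (Real.pi * (t ^ (2 / P.α j) * Real.exp (2 * P.m / P.α j))) *
        ENNReal.ofReal (Real.exp ((2 * P.σ j / P.α j) ^ 2 / 2) *
          Q (2 * P.σ j / P.α j - P.Upsilon j t)) := by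
    rw [← setLIntegral_Iic_exp_mul_gaussianReal, ← lintegral_const_mul _ (by fun_prop)]
    refine setLIntegral_congr_fun measurableSet_Iic fun w hw => ?_
    rw [min_eq_right ((P.reach_le_D_iff ht).2 hw), P.reach_sq ht,
      ← ENNReal.ofReal_mul (by positivity), ← mul_assoc Real.pi]
  have hfar : ∫⁻ w in Ioi (P.Upsilon j t), ENNReal.ofReal (Real.pi *
      min P.D (P.reach j t w) ^ 2) ∂(gaussianReal 0 1) =
      ENNReal.ofReal (Real.pi * P.D ^ 2) * ENNReal.ofReal (Q (P.Upsilon j t)) := by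
    rw [← gaussianReal_Ioi, ← setLIntegral_const]
    refine setLIntegral_congr_fun measurableSet_Ioi fun w hw => ?_
    rw [min_eq_left (lt_of_not_ge fun h => (not_le.2 hw) ((P.reach_le_D_iff ht).1 h)).le]
  have hexp : Real.exp (2 * P.σ j ^ 2 / P.α j ^ 2 + 2 * P.m / P.α j) =
      Real.exp (2 * P.m / P.α j) * Real.exp ((2 * P.σ j / P.α j) ^ 2 / 2) := by
    rw [← Real.exp_add]
    ring_nf
  have hdiv : 2 * P.σ j ^ 2 / (P.α j * P.σ j) = 2 * P.σ j / P.α j := by field_simp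
  rw [← lintegral_add_compl _ (measurableSet_Iic (a := P.Upsilon j t)), compl_Iic, hnear, hfar,
    ← ENNReal.ofReal_mul (by positivity), ← ENNReal.ofReal_mul (by positivity),
    ← ENNReal.ofReal_add (by positivity) (by positivity), discMean, scale, hdiv, hexp]
  ring_nf

lemma measurableSet_norm_le_D_and_pathLoss_le (j : LinkType) (t : ℝ) :
    MeasurableSet {z : Plane × ℝ | ‖z.1‖ ≤ P.D ∧ P.pathLoss j ‖z.1‖ z.2 ≤ t} := by
  rw [ofPred_and]
  exact (measurableSet_le (by fun_prop) measurable_const).inter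
    (measurableSet_le (by fun_prop) measurable_const)

lemma prod_shadowLaw_norm_le_D_and_pathLoss_le (j : LinkType) {t : ℝ} (ht : 0 < t) :
    (volume.prod (P.shadowLaw j)) {z : Plane × ℝ | ‖z.1‖ ≤ P.D ∧ P.pathLoss j ‖z.1‖ z.2 ≤ t} =
      ENNReal.ofReal (P.discMean j t) := by
  rw [P.prod_shadowLaw_apply j (P.measurableSet_norm_le_D_and_pathLoss_le j t)]
  simp only [mem_ofPred_eq, P.volume_norm_le_D_and_pathLoss_le ht, P.lintegral_min_D_reach j ht]

lemma linkIntensity_prod (j : LinkType) {A : Set (Plane × ℝ)} (hA : MeasurableSet A)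
    (T : Set Bool) :
    P.linkIntensity {z | (z.1.1, z.1.2 j) ∈ A ∧ z.2 ∈ T} =
      ENNReal.ofReal P.lamBS * (volume.prod (P.shadowLaw j)) A * P.unblockedLaw T := by
  have hproj : (volume.prod (Measure.infinitePi P.shadowLaw)).map
      (Prod.map id (fun s : LinkType → ℝ => s j)) =
      (volume : Measure Plane).prod (P.shadowLaw j) := by
    rw [← Measure.map_prod_map _ _ measurable_id (measurable_pi_apply j), Measure.map_id,
      Measure.infinitePi_map_eval]
  rw [← hproj, Measure.map_apply (by fun_prop) hA, linkIntensity, Measure.prod_smul_left,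
    Measure.prod_smul_left, Measure.smul_apply, smul_eq_mul, mul_assoc, ← Measure.prod_prod]
  rfl

/-- Type of the link `z`. -/
noncomputable def typeOf (z : Link) : LinkType :=
  open Classical in if z.2 = true ∧ ‖z.1.1‖ ≤ P.D then .los else .nlos

/-- Path loss of the link `z`. -/
noncomputable def lossOf (z : Link) : ℝ := P.pathLoss (P.typeOf z) ‖z.1.1‖ (z.1.2 (P.typeOf z))

/-- The links of type `j` with path loss at most `t`. -/
def lossRegion (j : LinkType) (t : ℝ) : Set Link := {z | P.typeOf z = j ∧ P.lossOf z ≤ t}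

lemma mem_lossRegion_iff (j : LinkType) (t : ℝ) (z : Link) :
    z ∈ P.lossRegion j t ↔ P.typeOf z = j ∧ P.pathLoss j ‖z.1.1‖ (z.1.2 j) ≤ t := by
  refine and_congr_right fun h => ?_
  rw [lossOf, h]

lemma lossRegion_los (t : ℝ) : P.lossRegion .los t =
    {z | (‖z.1.1‖ ≤ P.D ∧ P.pathLoss .los ‖z.1.1‖ (z.1.2 .los) ≤ t) ∧ z.2 = true} := by
  ext z
  simp only [mem_lossRegion_iff, typeOf, ite_eq_left_iff, mem_ofPred_eq, reduceCtorEq, imp_false,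
    not_not]
  tauto

lemma lossRegion_nlos (t : ℝ) : P.lossRegion .nlos t =
    {z | P.pathLoss .nlos ‖z.1.1‖ (z.1.2 .nlos) ≤ t} \
      {z | (‖z.1.1‖ ≤ P.D ∧ P.pathLoss .nlos ‖z.1.1‖ (z.1.2 .nlos) ≤ t) ∧ z.2 = true} := by
  ext z
  simp only [mem_lossRegion_iff, typeOf, ite_eq_right_iff, mem_ofPred_eq, reduceCtorEq, imp_false,
    Set.mem_sdiff]
  tauto

lemma measurable_typeOf : Measurable P.typeOf := by
  refine Measurable.ite ?_ measurable_const measurable_const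
  rw [ofPred_and]
  exact (measurableSet_eq_fun (by fun_prop) measurable_const).inter
    (measurableSet_le (by fun_prop) measurable_const)

lemma measurable_lossOf : Measurable P.lossOf := by
  classical
  have hcases : P.lossOf = fun z => if P.typeOf z = .los then
      P.pathLoss .los ‖z.1.1‖ (z.1.2 .los) else P.pathLoss .nlos ‖z.1.1‖ (z.1.2 .nlos) := by
    funext z
    rcases h : P.typeOf z <;> simp [lossOf, h]
  rw [hcases]
  exact Measurable.ite (P.measurable_typeOf (measurableSet_singleton _)) (by fun_prop)
    (by fun_prop)

lemma measurableSet_lossRegion (j : LinkType) (t : ℝ) : MeasurableSet (P.lossRegion j t) := by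
  rw [lossRegion, ofPred_and]
  exact (P.measurable_typeOf (measurableSet_singleton j)).inter
    (measurableSet_le P.measurable_lossOf measurable_const)

lemma lossRegion_of_nonpos (j : LinkType) {t : ℝ} (ht : t ≤ 0) : P.lossRegion j t = ∅ :=
  eq_empty_of_forall_notMem fun _ hz => ((P.pathLoss_pos _ _ _).trans_le hz.2).not_ge ht

lemma lossRegion_mono (j : LinkType) : Monotone (P.lossRegion j) :=
  fun _ _ h _ hz => ⟨hz.1, hz.2.trans h⟩

lemma linkIntensity_pathLoss_le (j : LinkType) {t : ℝ} (ht : 0 < t) :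
    P.linkIntensity {z | P.pathLoss j ‖z.1.1‖ (z.1.2 j) ≤ t} =
      ENNReal.ofReal (P.lamBS * (Real.pi * P.scale j t)) := by
  have h := P.linkIntensity_prod j (A := {y | P.pathLoss j ‖y.1‖ y.2 ≤ t})
    (measurableSet_le (by fun_prop) measurable_const) univ
  simpa only [P.prod_shadowLaw_pathLoss_le j ht, measure_univ, mul_one, mem_univ, and_true,
    ← ENNReal.ofReal_mul P.lamBS_pos.le, mem_ofPred_eq] using h

lemma linkIntensity_norm_le_D_and_pathLoss_le (j : LinkType) {t : ℝ} (ht : 0 < t) :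
    P.linkIntensity {z | (‖z.1.1‖ ≤ P.D ∧ P.pathLoss j ‖z.1.1‖ (z.1.2 j) ≤ t) ∧ z.2 = true} =
      ENNReal.ofReal (P.lamBS * (P.pLOS * P.discMean j t)) := by
  have h := P.linkIntensity_prod j (P.measurableSet_norm_le_D_and_pathLoss_le j t) {true}
  rw [P.prod_shadowLaw_norm_le_D_and_pathLoss_le j ht, unblockedLaw_true, mul_assoc,
    ← ENNReal.ofReal_mul (P.discMean_nonneg j ht.le), ← ENNReal.ofReal_mul P.lamBS_pos.le,
    mul_comm (P.discMean j t)] at h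
  exact h

lemma linkIntensity_lossRegion (j : LinkType) {t : ℝ} (ht : 0 < t) :
    P.linkIntensity (P.lossRegion j t) = ENNReal.ofReal (P.lamBS * P.M j t) := by
  cases j
  · rw [lossRegion_los, P.linkIntensity_norm_le_D_and_pathLoss_le _ ht, M_los]
  · have hmeas : MeasurableSet {z : Link | (‖z.1.1‖ ≤ P.D ∧
        P.pathLoss .nlos ‖z.1.1‖ (z.1.2 .nlos) ≤ t) ∧ z.2 = true} := by
      rw [ofPred_and, ofPred_and]
      exact ((measurableSet_le (by fun_prop) measurable_const).inter
        (measurableSet_le (by fun_prop) measurable_const)).inter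
        (measurableSet_eq_fun (by fun_prop) measurable_const)
    have hdisc := P.linkIntensity_norm_le_D_and_pathLoss_le .nlos ht
    rw [lossRegion_nlos, measure_sdiff (fun _ hz => mem_ofPred_eq ▸ hz.1.2) hmeas.nullMeasurableSet
      (hdisc ▸ ENNReal.ofReal_ne_top), P.linkIntensity_pathLoss_le _ ht, hdisc,
      ← ENNReal.ofReal_sub, M_nlos, mul_sub]
    exact mul_nonneg P.lamBS_pos.le (mul_nonneg P.pLOS_nonneg (P.discMean_nonneg _ ht.le))

lemma linkIntensity_lossRegion_ne_top (j : LinkType) (t : ℝ) :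
    P.linkIntensity (P.lossRegion j t) ≠ ∞ := by
  rcases le_or_gt t 0 with ht | ht
  · simp [P.lossRegion_of_nonpos j ht]
  · simp [P.linkIntensity_lossRegion j ht]

end LinkIntensity

end Params

namespace Params

variable (P : Params)

section Derivative

lemma hasDerivAt_Upsilon (j : LinkType) {t : ℝ} (ht : 0 < t) :
    HasDerivAt (P.Upsilon j) (-(1 / (t * P.σ j))) t := by
  have hD := P.D_pos
  have hσ := P.σ_pos j
  have hlog : P.Upsilon j =ᶠ[𝓝 t]
      fun t => (Real.log (P.D ^ P.α j) - Real.log t - P.m) / P.σ j := by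
    filter_upwards [lt_mem_nhds ht] with u hu
    rw [Upsilon, Real.log_div (by positivity) hu.ne']
  refine (((((Real.hasDerivAt_log ht.ne').const_sub _).sub_const _).div_const
    _).congr_of_eventuallyEq hlog).congr_deriv ?_
  field_simp

lemma tendsto_Upsilon_nhdsGT_zero (j : LinkType) : Tendsto (P.Upsilon j) (𝓝[>] 0) atTop := by
  have hD := P.D_pos
  have hlog : (fun t => (Real.log (P.D ^ P.α j) - P.m + -Real.log t) / P.σ j) =ᶠ[𝓝[>] 0]
      P.Upsilon j := by
    filter_upwards [self_mem_nhdsWithin] with u hu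
    rw [Upsilon, Real.log_div (by positivity) (ne_of_gt hu)]
    ring
  exact ((tendsto_atTop_add_const_left _ _
    (tendsto_neg_atBot_atTop.comp Real.tendsto_log_nhdsGT_zero)).atTop_div_const
      (P.σ_pos j)).congr' hlog

lemma hasDerivAt_scale (j : LinkType) {t : ℝ} (ht : 0 < t) :
    HasDerivAt (P.scale j) (2 / P.α j * t ^ (2 / P.α j - 1) *
      Real.exp (2 * P.σ j ^ 2 / P.α j ^ 2 + 2 * P.m / P.α j)) t :=
  (Real.hasDerivAt_rpow_const (Or.inl ht.ne')).mul_const _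

lemma tendsto_scale_nhdsGT_zero (j : LinkType) : Tendsto (P.scale j) (𝓝[>] 0) (𝓝 0) := by
  have hα := P.α_pos j
  have hpow : Tendsto (fun t : ℝ => t ^ (2 / P.α j)) (𝓝[>] 0) (𝓝 0) := by
    have h := (Real.continuousAt_rpow_const 0 (2 / P.α j) (Or.inr (by positivity))).tendsto
    rw [Real.zero_rpow (by positivity)] at h
    exact h.mono_left nhdsWithin_le_nhds
  have h := hpow.mul_const (Real.exp (2 * P.σ j ^ 2 / P.α j ^ 2 + 2 * P.m / P.α j))
  rwa [zero_mul] at h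

lemma tendsto_discMean_nhdsGT_zero (j : LinkType) :
    Tendsto (P.discMean j) (𝓝[>] 0) (𝓝 0) := by
  have hfar : Tendsto (fun t => Q (P.Upsilon j t)) (𝓝[>] 0) (𝓝 0) :=
    tendsto_Q_atTop.comp (P.tendsto_Upsilon_nhdsGT_zero j)
  have hnear : Tendsto (fun t => P.scale j t * Q (2 * P.σ j ^ 2 / (P.α j * P.σ j) -
      P.Upsilon j t)) (𝓝[>] 0) (𝓝 0) := by
    refine (P.tendsto_scale_nhdsGT_zero j).zero_mul_isBoundedUnder_le ⟨1, ?_⟩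
    rw [eventually_map]
    refine Eventually.of_forall fun t => ?_
    simpa [abs_of_nonneg (Q_nonneg _)] using Q_le_one _
  have h := ((hfar.const_mul (P.D ^ 2)).add hnear).const_mul Real.pi
  rwa [mul_zero, add_zero, mul_zero] at h

/-- The derivative of `discMean`. -/
noncomputable def discMean' (j : LinkType) (t : ℝ) : ℝ :=
  Real.pi * (Real.exp (2 * P.σ j ^ 2 / P.α j ^ 2 + 2 * P.m / P.α j) * t ^ (2 / P.α j - 1) *
      (2 / P.α j * Q (2 * P.σ j ^ 2 / (P.α j * P.σ j) - P.Upsilon j t) -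
        1 / √(2 * Real.pi * P.σ j ^ 2) *
          Real.exp (-(√2 * P.σ j / P.α j - P.Upsilon j t / √2) ^ 2)) +
    P.D ^ 2 / (√(2 * Real.pi) * t * P.σ j) * Real.exp (-(P.Upsilon j t ^ 2 / 2)))

lemma hasDerivAt_discMean (j : LinkType) {t : ℝ} (ht : 0 < t) :
    HasDerivAt (P.discMean j) (P.discMean' j t) t := by
  have hσ := P.σ_pos j
  have hα := P.α_pos j
  have : 0 < √(2 * Real.pi) := by positivity
  have hΥ := P.hasDerivAt_Upsilon j ht
  have hpdf (x : ℝ) : gaussianPDFReal 0 1 x = Real.exp (-(x ^ 2 / 2)) / √(2 * Real.pi) := by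
    simp [gaussianPDFReal, div_eq_inv_mul]
  have hsqrt : √(2 * Real.pi * P.σ j ^ 2) = √(2 * Real.pi) * P.σ j := by
    rw [Real.sqrt_mul (by positivity), Real.sqrt_sq hσ.le]
  have hsq : (√2 * P.σ j / P.α j - P.Upsilon j t / √2) ^ 2 =
      (2 * P.σ j ^ 2 / (P.α j * P.σ j) - P.Upsilon j t) ^ 2 / 2 := by
    have htwo : √2 ^ 2 = (2 : ℝ) := Real.sq_sqrt (by norm_num)
    have hfactor : √2 * P.σ j / P.α j - P.Upsilon j t / √2 =
        (2 * P.σ j ^ 2 / (P.α j * P.σ j) - P.Upsilon j t) / √2 := by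
      field_simp
      rw [htwo]
      ring
    rw [hfactor, div_pow, htwo]
  have hpow : t ^ (2 / P.α j) = t ^ (2 / P.α j - 1) * t := by
    rw [Real.rpow_sub_one ht.ne']
    field_simp
  refine (((((hasDerivAt_Q _).comp t hΥ).const_mul (P.D ^ 2)).add ((P.hasDerivAt_scale j ht).mul
    ((hasDerivAt_Q _).comp t (hΥ.const_sub _)))).const_mul Real.pi).congr_deriv ?_
  simp only [Function.comp_apply, scale, discMean', hpdf, hsqrt, hsq, hpow]
  field_simp
  ring

lemma hasDerivAt_M (j : LinkType) {t : ℝ} (ht : 0 < t) : HasDerivAt (P.M j) (P.M' j t) t := by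
  cases j
  · rw [funext P.M_los]
    refine ((P.hasDerivAt_discMean .los ht).const_mul P.pLOS).congr_deriv ?_
    simp only [M', discMean']
    ring
  · rw [funext P.M_nlos]
    refine (((P.hasDerivAt_scale .nlos ht).const_mul Real.pi).sub
      ((P.hasDerivAt_discMean .nlos ht).const_mul P.pLOS)).congr_deriv ?_
    simp only [M', discMean']
    ring

lemma tendsto_M_nhdsGT_zero (j : LinkType) : Tendsto (P.M j) (𝓝[>] 0) (𝓝 0) := by
  cases j
  · simpa only [funext P.M_los, mul_zero] using
      (P.tendsto_discMean_nhdsGT_zero .los).const_mul P.pLOS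
  · simpa only [funext P.M_nlos, mul_zero, sub_zero] using
      ((P.tendsto_scale_nhdsGT_zero .nlos).const_mul Real.pi).sub
        ((P.tendsto_discMean_nhdsGT_zero .nlos).const_mul P.pLOS)

end Derivative

section LossDensity

lemma discMean_le (j : LinkType) {t : ℝ} (ht : 0 < t) :
    P.discMean j t ≤ Real.pi * P.scale j t := by
  have := P.scale_nonneg j ht.le
  rw [← ENNReal.ofReal_le_ofReal_iff (by positivity),
    ← P.prod_shadowLaw_norm_le_D_and_pathLoss_le j ht, ← P.prod_shadowLaw_pathLoss_le j ht]
  exact measure_mono fun z hz => hz.2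

lemma M_nonneg (j : LinkType) {t : ℝ} (ht : 0 < t) : 0 ≤ P.M j t := by
  cases j
  · rw [M_los]
    exact mul_nonneg P.pLOS_nonneg (P.discMean_nonneg .los ht.le)
  · rw [M_nlos, sub_nonneg]
    exact (mul_le_of_le_one_left (P.discMean_nonneg .nlos ht.le) P.pLOS_le_one).trans
      (P.discMean_le .nlos ht)

lemma real_linkIntensity_lossRegion (j : LinkType) {t : ℝ} (ht : 0 < t) :
    P.linkIntensity.real (P.lossRegion j t) = P.lamBS * P.M j t := by
  rw [measureReal_def, P.linkIntensity_lossRegion j ht,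
    ENNReal.toReal_ofReal (mul_nonneg P.lamBS_pos.le (P.M_nonneg j ht))]

lemma monotone_real_linkIntensity_lossRegion (j : LinkType) :
    Monotone fun t => P.linkIntensity.real (P.lossRegion j t) := fun _ b h =>
  measureReal_mono (P.lossRegion_mono j h) (P.linkIntensity_lossRegion_ne_top j b)

lemma hasDerivAt_real_linkIntensity_lossRegion (j : LinkType) {t : ℝ} (ht : 0 < t) :
    HasDerivAt (fun u => P.linkIntensity.real (P.lossRegion j u)) (P.lamBS * P.M' j t) t := by
  refine ((P.hasDerivAt_M j ht).const_mul P.lamBS).congr_of_eventuallyEq ?_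
  filter_upwards [lt_mem_nhds ht] with u hu using P.real_linkIntensity_lossRegion j hu

/-- The probability that no link of type `j` has path loss at most `t`. -/
noncomputable def lossTail (j : LinkType) (t : ℝ) : ℝ :=
  Real.exp (-P.linkIntensity.real (P.lossRegion j t))

/-- The density on `(0, ∞)` of the least path loss among the links of type `j`; its mass is the
probability that there is such a link. -/
noncomputable def lossDensity (j : LinkType) (t : ℝ) : ℝ :=
  P.lamBS * P.M' j t * P.lossTail j t

lemma lossTail_pos (j : LinkType) (t : ℝ) : 0 < P.lossTail j t := Real.exp_pos _

lemma lossTail_of_pos (j : LinkType) {t : ℝ} (ht : 0 < t) :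
    P.lossTail j t = Real.exp (-(P.lamBS * P.M j t)) := by
  rw [lossTail, P.real_linkIntensity_lossRegion j ht]

lemma lossTail_of_nonpos (j : LinkType) {t : ℝ} (ht : t ≤ 0) : P.lossTail j t = 1 := by
  simp [lossTail, P.lossRegion_of_nonpos j ht]

lemma lossTail_le_one (j : LinkType) (t : ℝ) : P.lossTail j t ≤ 1 :=
  Real.exp_le_one_iff.2 (neg_nonpos.2 measureReal_nonneg)

lemma antitone_lossTail (j : LinkType) : Antitone (P.lossTail j) := fun _ _ h =>
  Real.exp_le_exp.2 (neg_le_neg (P.monotone_real_linkIntensity_lossRegion j h))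

lemma lossDensity_nonneg (j : LinkType) {t : ℝ} (ht : 0 < t) : 0 ≤ P.lossDensity j t := by
  refine mul_nonneg ?_ (P.lossTail_pos j t).le
  rw [← (P.hasDerivAt_real_linkIntensity_lossRegion j ht).deriv]
  exact (P.monotone_real_linkIntensity_lossRegion j).deriv_nonneg

lemma hasDerivAt_neg_lossTail (j : LinkType) {t : ℝ} (ht : 0 < t) :
    HasDerivAt (fun t => -P.lossTail j t) (P.lossDensity j t) t := by
  refine (P.hasDerivAt_real_linkIntensity_lossRegion j ht).fun_neg.exp.fun_neg.congr_deriv ?_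
  rw [lossDensity, lossTail]
  ring

lemma continuousWithinAt_lossTail_zero (j : LinkType) :
    ContinuousWithinAt (P.lossTail j) (Ici 0) 0 := by
  rw [← continuousWithinAt_Ioi_iff_Ici, ContinuousWithinAt, P.lossTail_of_nonpos j le_rfl]
  have h := ((P.tendsto_M_nhdsGT_zero j).const_mul P.lamBS).neg.rexp
  rw [mul_zero, neg_zero, Real.exp_zero] at h
  refine h.congr' ?_
  filter_upwards [self_mem_nhdsWithin] with u hu using (P.lossTail_of_pos j hu).symm

lemma integrableOn_lossDensity (j : LinkType) : IntegrableOn (P.lossDensity j) (Ioi 0) := by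
  refine integrableOn_Ioi_deriv_of_nonneg (P.continuousWithinAt_lossTail_zero j).neg
    (fun t ht => P.hasDerivAt_neg_lossTail j ht) (fun t ht => P.lossDensity_nonneg j ht)
    (tendsto_atTop_ciSup (P.antitone_lossTail j).neg ⟨0, ?_⟩)
  rintro _ ⟨t, rfl⟩
  exact neg_nonpos.2 (P.lossTail_pos j t).le

lemma setIntegral_lossDensity (j : LinkType) {t : ℝ} (ht : 0 ≤ t) :
    ∫ u in Ioc 0 t, P.lossDensity j u = 1 - P.lossTail j t := by
  have hcont : ContinuousOn (fun t => -P.lossTail j t) (Icc 0 t) := by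
    intro u hu
    rcases eq_or_lt_of_le hu.1 with rfl | h
    · exact (P.continuousWithinAt_lossTail_zero j).neg.mono Icc_subset_Ici_self
    · exact (P.hasDerivAt_neg_lossTail j h).continuousAt.continuousWithinAt
  rw [← intervalIntegral.integral_of_le ht,
    intervalIntegral.integral_eq_sub_of_hasDerivAt_of_le ht hcont
      (fun u hu => P.hasDerivAt_neg_lossTail j hu.1)
      ((intervalIntegrable_iff_integrableOn_Ioc_of_le ht).2
        ((P.integrableOn_lossDensity j).mono_set Ioc_subset_Ioi_self)),
    P.lossTail_of_nonpos j le_rfl]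
  ring

lemma setLIntegral_lossDensity (j : LinkType) {t : ℝ} (ht : 0 ≤ t) :
    ∫⁻ u in Ioc 0 t, ENNReal.ofReal (P.lossDensity j u) =
      1 - ENNReal.ofReal (P.lossTail j t) := by
  rw [← ofReal_integral_eq_lintegral_ofReal
    ((P.integrableOn_lossDensity j).mono_set Ioc_subset_Ioi_self)
    ((ae_restrict_iff' measurableSet_Ioc).2 (Eventually.of_forall fun u hu =>
      P.lossDensity_nonneg j hu.1)), P.setIntegral_lossDensity j ht,
    ENNReal.ofReal_sub _ (P.lossTail_pos j t).le, ENNReal.ofReal_one]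

end LossDensity

section Coverage

lemma f_eq (j : LinkType) {t : ℝ} (ht : 0 < t) : P.f j t = P.lossDensity j t / P.B j := by
  rw [lossDensity, P.lossTail_of_pos j ht, f]
  ring

lemma B_mul_f (j : LinkType) {t : ℝ} (ht : 0 < t) : P.B j * P.f j t = P.lossDensity j t := by
  rw [P.f_eq j ht]
  refine mul_div_cancel_of_imp' fun hB => ?_
  cases j
  · have hp : P.pLOS = 0 := by
      have := P.lamBS_pos
      have := P.D_pos
      have : P.lamBS * Real.pi * P.pLOS * P.D ^ 2 = 0 := by
        simpa [B, sub_eq_zero, eq_comm (a := (1 : ℝ))] using hB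
      simp_all [ne_of_gt, Real.pi_pos]
    simp [lossDensity, M', hp]
  · simp [B] at hB

lemma G_pos : 0 < P.G := by
  have := P.power_pos
  have := P.NBS_pos
  have := P.NUE_pos
  unfold G
  positivity

lemma snrThreshold_nonneg {τ : ℝ} (hτ : 0 ≤ τ) (n : ℕ) : 0 ≤ P.snrThreshold τ n := by
  have := P.eff_pos
  have := P.bandwidth_pos
  rw [snrThreshold, sub_nonneg]
  exact Real.one_le_rpow (by norm_num) (by positivity)

/-- The fading power that, per unit of path loss, the strongest path of a serving link of type `j`
must exceed for an SNR above `τ` when `U` users are served. -/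
noncomputable def fadingThreshold (j : LinkType) (τ : ℝ) (U : ℕ) : ℝ :=
  P.η j * τ * U * P.noise / P.G

lemma fadingThreshold_nonneg (j : LinkType) {τ : ℝ} (hτ : 0 ≤ τ) (U : ℕ) :
    0 ≤ P.fadingThreshold j τ U := by
  have := P.G_pos
  have := P.noise_pos
  unfold fadingThreshold
  positivity

lemma covIntegrand_eq (j : LinkType) (τ : ℝ) (U n : ℕ) {l : ℝ} (hl : 0 < l) :
    P.covIntegrand j τ U n l =
      Real.exp (-(n * P.fadingThreshold j τ U * l)) * P.lossTail j.other l * P.f j l := by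
  rw [covIntegrand, P.lossTail_of_pos _ hl, ← Real.exp_add, fadingThreshold]
  ring_nf

lemma B_mul_covIntegrand (j : LinkType) (τ : ℝ) (U n : ℕ) {l : ℝ} (hl : 0 < l) :
    P.B j * P.covIntegrand j τ U n l =
      Real.exp (-(n * P.fadingThreshold j τ U * l)) * P.lossTail j.other l *
        P.lossDensity j l := by
  rw [P.covIntegrand_eq j τ U n hl, ← P.B_mul_f j hl]
  ring

lemma integrableOn_exp_mul_lossTail_mul_lossDensity (j : LinkType) {c : ℝ} (hc : 0 ≤ c) :
    IntegrableOn (fun l => Real.exp (-(c * l)) * P.lossTail j.other l * P.lossDensity j l)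
      (Ioi 0) := by
  refine Integrable.bdd_mul (c := 1) (P.integrableOn_lossDensity j) ?_ ?_
  · exact (Continuous.aestronglyMeasurable (by fun_prop)).mul
      (P.antitone_lossTail _).measurable.aestronglyMeasurable
  · refine (ae_restrict_iff' measurableSet_Ioi).2 (Eventually.of_forall fun l hl => ?_)
    rw [Real.norm_of_nonneg (mul_nonneg (Real.exp_pos _).le (P.lossTail_pos _ _).le)]
    refine mul_le_one₀ ?_ (P.lossTail_pos _ _).le (P.lossTail_le_one _ _)
    rw [Real.exp_le_one_iff, neg_nonpos]
    exact mul_nonneg hc (le_of_lt hl)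

lemma integrableOn_covIntegrand (j : LinkType) {τ : ℝ} (hτ : 0 ≤ τ) (U n : ℕ) :
    IntegrableOn (P.covIntegrand j τ U n) (Ioi 0) := by
  have := P.fadingThreshold_nonneg j hτ U
  refine IntegrableOn.congr_fun ((P.integrableOn_exp_mul_lossTail_mul_lossDensity j
    (c := n * P.fadingThreshold j τ U) (by positivity)).div_const (P.B j)) (fun l hl => ?_)
      measurableSet_Ioi
  rw [P.covIntegrand_eq j τ U n hl, P.f_eq j hl, mul_div_assoc]

end Coverage

end Params

section ComplexNormal

lemma gaussianPDFReal_zero_half (a : ℝ) :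
    gaussianPDFReal 0 (1 / 2) a = (√Real.pi)⁻¹ * Real.exp (-a ^ 2) := by
  simp only [gaussianPDFReal, NNReal.coe_div, NNReal.coe_one, NNReal.coe_ofNat, sub_zero]
  field_simp

lemma gaussianPDF_zero_half_mul (a b : ℝ) :
    gaussianPDF 0 (1 / 2) a * gaussianPDF 0 (1 / 2) b =
      ENNReal.ofReal (Real.pi⁻¹ * Real.exp (-(a ^ 2 + b ^ 2))) := by
  rw [gaussianPDF_def, ← ENNReal.ofReal_mul (gaussianPDFReal_nonneg _ _ _),
    gaussianPDFReal_zero_half, gaussianPDFReal_zero_half, mul_mul_mul_comm, ← Real.exp_add,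
    ← mul_inv, Real.mul_self_sqrt Real.pi_pos.le, ← neg_add]

lemma complexNormal_eq_withDensity :
    complexNormal = volume.withDensity fun z : ℂ =>
      ENNReal.ofReal (Real.pi⁻¹ * Real.exp (-‖z‖ ^ 2)) := by
  let e := Complex.measurableEquivRealProd.symm
  have hmap : complexNormal =
      ((gaussianReal 0 (1 / 2)).prod (gaussianReal 0 (1 / 2))).map e := rfl
  ext s hs
  rw [hmap, Measure.map_apply e.measurable hs,
    gaussianReal_of_var_ne_zero 0 (by norm_num : (1 / 2 : ℝ≥0) ≠ 0),
    prod_withDensity (measurable_gaussianPDF _ _) (measurable_gaussianPDF _ _),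
    withDensity_apply _ (e.measurable hs), withDensity_apply _ hs, ← Measure.volume_eq_prod,
    ← Complex.volume_preserving_equiv_real_prod.symm.setLIntegral_comp_preimage hs (by fun_prop)]
  refine setLIntegral_congr_fun (e.measurable hs) fun p _ => ?_
  rw [gaussianPDF_zero_half_mul, Complex.sq_norm, Complex.normSq_apply, ← sq, ← sq]
  rfl

lemma integral_Ioi_mul_exp_neg_sq {a : ℝ} (ha : 0 ≤ a) :
    ∫ r in Ioi a, 2 * r * Real.exp (-r ^ 2) = Real.exp (-a ^ 2) := by
  have hderiv (r : ℝ) : HasDerivAt (fun r => -Real.exp (-r ^ 2)) (2 * r * Real.exp (-r ^ 2)) r := by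
    refine ((hasDerivAt_pow 2 r).fun_neg.exp.fun_neg).congr_deriv ?_
    push_cast
    ring
  have hnonneg : ∀ r ∈ Ioi a, 0 ≤ 2 * r * Real.exp (-r ^ 2) := fun r hr => by
    have : 0 < r := ha.trans_lt hr
    positivity
  have hlim : Tendsto (fun r : ℝ => -Real.exp (-r ^ 2)) atTop (𝓝 0) := by
    simpa using (Real.tendsto_exp_atBot.comp
      (tendsto_neg_atTop_atBot.comp (tendsto_pow_atTop two_ne_zero))).neg
  rw [integral_Ioi_of_hasDerivAt_of_nonneg' (fun r _ => hderiv r) hnonneg hlim, zero_sub, neg_neg]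

lemma complexNormal_real_lt_norm_sq {x : ℝ} (hx : 0 ≤ x) :
    complexNormal.real {z | x < ‖z‖ ^ 2} = Real.exp (-x) := by
  have hs : MeasurableSet {z : ℂ | x < ‖z‖ ^ 2} := measurableSet_lt measurable_const (by fun_prop)
  have hind (z : ℂ) :
      {z : ℂ | x < ‖z‖ ^ 2}.indicator (fun z => Real.pi⁻¹ * Real.exp (-‖z‖ ^ 2)) z =
        (Ioi √x).indicator (fun r => Real.pi⁻¹ * Real.exp (-r ^ 2)) ‖z‖ := by
    simp only [indicator_apply, mem_ofPred_eq, mem_Ioi, Real.sqrt_lt hx (norm_nonneg z)]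
  calc complexNormal.real {z | x < ‖z‖ ^ 2}
    _ = ∫ z in {z : ℂ | x < ‖z‖ ^ 2}, Real.pi⁻¹ * Real.exp (-‖z‖ ^ 2) := by
      rw [measureReal_def, complexNormal_eq_withDensity, withDensity_apply _ hs,
        integral_eq_lintegral_of_nonneg_ae (.of_forall fun z => by positivity) (by fun_prop)]
    _ = 2 * (Real.pi * ∫ r in Ioi (0 : ℝ),
          r * (Ioi √x).indicator (fun r => Real.pi⁻¹ * Real.exp (-r ^ 2)) r) := by
      rw [← integral_indicator hs]
      simp only [hind]
      rw [integral_fun_norm_addHaar, Complex.finrank_real_complex, measureReal_def,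
        Complex.volume_ball]
      simp
    _ = ∫ r in Ioi √x, 2 * r * Real.exp (-r ^ 2) := by
      simp only [← indicator_mul_right (Ioi √x) fun r : ℝ => r]
      rw [setIntegral_indicator measurableSet_Ioi,
        inter_eq_right.2 (Ioi_subset_Ioi (Real.sqrt_nonneg x)), ← mul_assoc,
        ← integral_const_mul]
      refine integral_congr_ae (.of_forall fun r => ?_)
      simp only []
      field_simp
    _ = Real.exp (-x) := by
      rw [integral_Ioi_mul_exp_neg_sq (Real.sqrt_nonneg x), Real.sq_sqrt hx]

end ComplexNormal

section FadingTail

/-- Probability that the strongest of `N` independent Rayleigh fading paths has power more than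
`x`. -/
noncomputable def fadingTail (N : ℕ) (x : ℝ) : ℝ := 1 - (1 - Real.exp (-x)) ^ N

@[fun_prop]
lemma measurable_fadingTail (N : ℕ) : Measurable (fadingTail N) := by
  unfold fadingTail
  fun_prop

lemma fadingTail_nonneg (N : ℕ) {x : ℝ} (hx : 0 ≤ x) : 0 ≤ fadingTail N x := by
  have h : Real.exp (-x) ≤ 1 := Real.exp_le_one_iff.2 (neg_nonpos.2 hx)
  exact sub_nonneg.2 (pow_le_one₀ (sub_nonneg.2 h) (sub_le_self 1 (Real.exp_pos _).le))

lemma one_sub_one_sub_pow {R : Type*} [CommRing R] (y : R) (N : ℕ) :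
    1 - (1 - y) ^ N = ∑ n ∈ Finset.Icc 1 N, (-1) ^ (n + 1) * N.choose n * y ^ n := by
  rw [sub_eq_neg_add 1 y, add_pow, Finset.range_eq_Ico, Finset.sum_eq_sum_Ico_succ_bot N.succ_pos,
    zero_add, Nat.succ_eq_add_one, Finset.Ico_add_one_right_eq_Icc]
  simp only [pow_zero, one_pow, Nat.choose_zero_right, Nat.cast_one, mul_one,
    sub_add_cancel_left, ← Finset.sum_neg_distrib]
  refine Finset.sum_congr rfl fun n _ => ?_
  rw [neg_pow y]
  ring

lemma measure_lt_iSup_of_iIndepFun {Ω : Type*} [MeasurableSpace Ω] {μ : Measure Ω}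
    [IsProbabilityMeasure μ] {N : ℕ} (hN : 0 < N) {X : Fin N → Ω → ℝ}
    (hX : ∀ k, Measurable (X k)) (hind : iIndepFun X μ) {x p : ℝ}
    (hp : ∀ k, μ.real {ω | x < X k ω} = p) :
    μ.real {ω | x < ⨆ k, X k ω} = 1 - (1 - p) ^ N := by
  have : Nonempty (Fin N) := ⟨⟨0, hN⟩⟩
  have hmeas (k : Fin N) : MeasurableSet {ω | X k ω ≤ x} := measurableSet_le (hX k) measurable_const
  have hcompl : {ω | x < ⨆ k, X k ω} = (⋂ k, {ω | X k ω ≤ x})ᶜ := by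
    ext ω
    simp only [mem_ofPred_eq, mem_compl_iff, mem_iInter, ← not_le,
      ciSup_le_iff (Finite.bddAbove_range fun k => X k ω)]
  have hle (k : Fin N) : μ.real {ω | X k ω ≤ x} = 1 - p := by
    rw [← hp k, ← probReal_compl_eq_one_sub (measurableSet_lt measurable_const (hX k))]
    simp only [compl_ofPred, not_lt]
  have hprod : μ (⋂ k, {ω | X k ω ≤ x}) = ∏ k, μ {ω | X k ω ≤ x} := by
    have := hind.measure_inter_preimage_eq_mul Finset.univ (sets := fun _ => Iic x)
      fun _ _ => measurableSet_Iic
    simpa only [Finset.mem_univ, iInter_true, Iic, preimage_ofPred_eq] using this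
  rw [hcompl, probReal_compl_eq_one_sub (.iInter hmeas), measureReal_def, hprod,
    ENNReal.toReal_prod]
  simp only [← measureReal_def, hle, Finset.prod_const, Finset.card_univ, Fintype.card_fin]

end FadingTail

section CoverageTerm

namespace Params

variable (P : Params)

lemma fadingTail_fadingThreshold_mul (j : LinkType) (τ : ℝ) (U : ℕ) {l : ℝ} (hl : 0 < l) :
    fadingTail (P.η j) (P.fadingThreshold j τ U * l) * (P.lossTail j.other l * P.lossDensity j l) =
      ∑ n ∈ Finset.Icc 1 (P.η j),
        (-1) ^ (n + 1) * (P.η j).choose n * (P.B j * P.covIntegrand j τ U n l) := by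
  rw [fadingTail, one_sub_one_sub_pow, Finset.sum_mul]
  refine Finset.sum_congr rfl fun n _ => ?_
  rw [P.B_mul_covIntegrand j τ U n hl, ← Real.exp_nat_mul]
  ring_nf

lemma integrableOn_fadingTail (j : LinkType) {τ : ℝ} (hτ : 0 ≤ τ) (U : ℕ) :
    IntegrableOn (fun l => fadingTail (P.η j) (P.fadingThreshold j τ U * l) *
      (P.lossTail j.other l * P.lossDensity j l)) (Ioi 0) := by
  have hint : IntegrableOn (fun l => ∑ n ∈ Finset.Icc 1 (P.η j),
      (-1) ^ (n + 1) * (P.η j).choose n * (P.B j * P.covIntegrand j τ U n l)) (Ioi 0) :=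
    integrable_finsetSum _ fun n _ =>
      ((P.integrableOn_covIntegrand j hτ U n).const_mul (P.B j)).const_mul _
  exact hint.congr_fun (fun l hl => (P.fadingTail_fadingThreshold_mul j τ U hl).symm)
    measurableSet_Ioi

lemma covTerm_eq_zeta_mul_integral (j : LinkType) {τ : ℝ} (hτ : 0 ≤ τ) (U : ℕ) :
    P.covTerm j τ U = P.zeta (P.η j) U *
      ∫ l in Ioi 0, fadingTail (P.η j) (P.fadingThreshold j τ U * l) *
        (P.lossTail j.other l * P.lossDensity j l) := by
  have hint (n : ℕ) := ((P.integrableOn_covIntegrand j hτ U n).const_mul (P.B j)).const_mul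
    ((-1) ^ (n + 1) * ((P.η j).choose n : ℝ))
  rw [setIntegral_congr_fun measurableSet_Ioi
    fun l hl => P.fadingTail_fadingThreshold_mul j τ U hl, integral_finsetSum _ fun n _ => hint n,
    covTerm, mul_comm (P.B j), mul_assoc, Finset.mul_sum]
  simp only [integral_const_mul, mul_left_comm (P.B j)]

lemma fadingTail_mul_nonneg (j : LinkType) {τ : ℝ} (hτ : 0 ≤ τ) (U : ℕ) {l : ℝ} (hl : 0 < l) :
    0 ≤ fadingTail (P.η j) (P.fadingThreshold j τ U * l) *
      (P.lossTail j.other l * P.lossDensity j l) :=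
  mul_nonneg (fadingTail_nonneg _ (mul_nonneg (P.fadingThreshold_nonneg j hτ U) hl.le))
    (mul_nonneg (P.lossTail_pos _ _).le (P.lossDensity_nonneg j hl))

lemma ofReal_covTerm (j : LinkType) {τ : ℝ} (hτ : 0 ≤ τ) {U : ℕ} (hζ : 0 ≤ P.zeta (P.η j) U) :
    ENNReal.ofReal (P.covTerm j τ U) = ENNReal.ofReal (P.zeta (P.η j) U) *
      ∫⁻ l in Ioi 0, ENNReal.ofReal (fadingTail (P.η j) (P.fadingThreshold j τ U * l)) *
        ENNReal.ofReal (P.lossTail j.other l * P.lossDensity j l) := by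
  rw [P.covTerm_eq_zeta_mul_integral j hτ, ENNReal.ofReal_mul hζ,
    ofReal_integral_eq_lintegral_ofReal (P.integrableOn_fadingTail j hτ U)
      (ae_restrict_of_forall_mem measurableSet_Ioi fun l hl => P.fadingTail_mul_nonneg j hτ U hl)]
  congr 1
  refine setLIntegral_congr_fun measurableSet_Ioi fun l hl => ENNReal.ofReal_mul ?_
  exact fadingTail_nonneg _ (mul_nonneg (P.fadingThreshold_nonneg j hτ U) (le_of_lt hl))

lemma covTerm_nonneg (j : LinkType) {τ : ℝ} (hτ : 0 ≤ τ) {U : ℕ}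
    (hζ : 0 ≤ P.zeta (P.η j) U) : 0 ≤ P.covTerm j τ U := by
  rw [P.covTerm_eq_zeta_mul_integral j hτ]
  exact mul_nonneg hζ (setIntegral_nonneg measurableSet_Ioi fun l hl =>
    P.fadingTail_mul_nonneg j hτ U hl)

end Params

end CoverageTerm

namespace Params

variable (P : Params)

section Association

/-- Index of the serving link in a configuration of links: the first one of least path loss. -/
noncomputable def servingIndex (x : ℕ → Link) : ℕ := sInf {i | ∀ k, P.lossOf (x i) ≤ P.lossOf (x k)}

/-- The serving link in a configuration of links. -/
noncomputable def servingLink (x : ℕ → Link) : Link := x (P.servingIndex x)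

/-- Least path loss among the links of type `j` in a configuration, and `∞` if there is no such
link. -/
noncomputable def leastLoss (j : LinkType) (x : ℕ → Link) : ℝ≥0∞ :=
  ⨅ (i) (_ : P.typeOf (x i) = j), ENNReal.ofReal (P.lossOf (x i))

variable {x : ℕ → Link}

lemma lossOf_pos (z : Link) : 0 < P.lossOf z := P.pathLoss_pos _ _ _

lemma leastLoss_le {j : LinkType} {i : ℕ} (h : P.typeOf (x i) = j) :
    P.leastLoss j x ≤ ENNReal.ofReal (P.lossOf (x i)) :=
  iInf₂_le i h

lemma exists_leastLoss_eq (hx : Tendsto (fun i => P.lossOf (x i)) cofinite atTop) {j : LinkType}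
    (h : P.leastLoss j x ≠ ∞) :
    ∃ i, P.typeOf (x i) = j ∧ P.leastLoss j x = ENNReal.ofReal (P.lossOf (x i)) := by
  have hne : {i | P.typeOf (x i) = j}.Nonempty := by
    by_contra! hempty
    exact h (iInf₂_eq_top.2 fun i hi => absurd hi (eq_empty_iff_forall_notMem.1 hempty i))
  obtain ⟨i, hi, hmin⟩ := hx.exists_within_forall_le hne
  exact ⟨i, hi, le_antisymm (P.leastLoss_le hi)
    (le_iInf₂ fun k hk => ENNReal.ofReal_le_ofReal (hmin k hk))⟩

lemma lt_leastLoss_iff (hx : Tendsto (fun i => P.lossOf (x i)) cofinite atTop) (j : LinkType)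
    (s : ℝ≥0) : s < P.leastLoss j x ↔ ∀ i, x i ∉ P.lossRegion j s := by
  refine ⟨fun h i hi => ?_, fun h => ?_⟩
  · exact (h.trans_le (P.leastLoss_le hi.1)).not_ge (ENNReal.ofReal_le_coe.2 hi.2)
  · by_contra! hle
    obtain ⟨i, hi, heq⟩ := P.exists_leastLoss_eq hx (ne_top_of_le_ne_top ENNReal.coe_ne_top hle)
    exact h i ⟨hi, ENNReal.ofReal_le_coe.1 (heq ▸ hle)⟩

lemma lossOf_servingLink_le (hx : Tendsto (fun i => P.lossOf (x i)) cofinite atTop) (k : ℕ) :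
    P.lossOf (P.servingLink x) ≤ P.lossOf (x k) := by
  have hmin : P.servingIndex x ∈ {i | ∀ k, P.lossOf (x i) ≤ P.lossOf (x k)} :=
    Nat.sInf_mem hx.exists_forall_le
  exact hmin k

lemma ofReal_lossOf_servingLink_le_leastLoss
    (hx : Tendsto (fun i => P.lossOf (x i)) cofinite atTop) (j : LinkType) :
    ENNReal.ofReal (P.lossOf (P.servingLink x)) ≤ P.leastLoss j x :=
  le_iInf₂ fun i _ => ENNReal.ofReal_le_ofReal (P.lossOf_servingLink_le hx i)

lemma leastLoss_typeOf_servingLink (hx : Tendsto (fun i => P.lossOf (x i)) cofinite atTop) :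
    P.leastLoss (P.typeOf (P.servingLink x)) x = ENNReal.ofReal (P.lossOf (P.servingLink x)) :=
  (P.leastLoss_le rfl).antisymm (P.ofReal_lossOf_servingLink_le_leastLoss hx _)

lemma typeOf_servingLink_eq_iff (hx : Tendsto (fun i => P.lossOf (x i)) cofinite atTop)
    (hne : ∀ j, P.leastLoss j x < ∞ → P.leastLoss j.other x ≠ P.leastLoss j x) (j : LinkType) :
    P.typeOf (P.servingLink x) = j ↔ P.leastLoss j x < P.leastLoss j.other x := by
  have hlt (k : LinkType) (hk : P.typeOf (P.servingLink x) = k) :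
      P.leastLoss k x < P.leastLoss k.other x := by
    have heq := hk ▸ P.leastLoss_typeOf_servingLink hx
    exact lt_of_le_of_ne (heq.trans_le (P.ofReal_lossOf_servingLink_le_leastLoss hx _))
      (hne k (heq ▸ ENNReal.ofReal_lt_top)).symm
  refine ⟨hlt j, fun h => ?_⟩
  by_contra hj
  have hother : P.typeOf (P.servingLink x) = j.other := by
    revert hj
    cases P.typeOf (P.servingLink x) <;> cases j <;> simp [LinkType.other]
  have hgt := hlt _ hother
  rw [show j.other.other = j by cases j <;> rfl] at hgt
  exact h.asymm hgt

@[fun_prop]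
lemma measurable_leastLoss (j : LinkType) : Measurable (P.leastLoss j) := by
  classical
  unfold leastLoss
  simp_rw [iInf_eq_if]
  exact .iInf fun i => .ite (P.measurable_typeOf.comp (measurable_pi_apply i)
    (measurableSet_singleton j)) (P.measurable_lossOf.comp (measurable_pi_apply i)).ennreal_ofReal
    measurable_const

lemma measurable_servingIndex : Measurable P.servingIndex := by
  refine measurable_sInf_nat fun i => ?_
  rw [ofPred_forall]
  exact .iInter fun k => measurableSet_le (P.measurable_lossOf.comp (measurable_pi_apply i))
    (P.measurable_lossOf.comp (measurable_pi_apply k))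

lemma measurable_servingLink : Measurable P.servingLink :=
  (measurable_from_prod_countable_right (f := fun z : ℕ × (ℕ → Link) => z.2 z.1)
    fun i => measurable_pi_apply i).comp (P.measurable_servingIndex.prodMk measurable_id)

end Association

section PoissonLinks

variable {ν : Measure (ℕ → Link)} [IsProbabilityMeasure ν]

lemma ae_tendsto_lossOf (hν : HasPoissonPGFL (fun i x => x i) P.linkIntensity ν) :
    ∀ᵐ x ∂ν, Tendsto (fun i => P.lossOf (x i)) cofinite atTop := by
  have hfin (j : LinkType) (n : ℕ) : ∀ᵐ x ∂ν, {i | x i ∈ P.lossRegion j n}.Finite :=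
    hν.ae_finite_setOf_mem (P.measurableSet_lossRegion j n) (P.linkIntensity_lossRegion_ne_top j n)
  filter_upwards [ae_all_iff.2 fun n => (hfin .los n).and (hfin .nlos n)] with x hx
  refine tendsto_atTop.2 fun b => ?_
  obtain ⟨n, hn⟩ := exists_nat_ge b
  refine eventually_cofinite.2 (((hx n).1.union (hx n).2).subset fun i hi => ?_)
  have hle : P.lossOf (x i) ≤ n := (not_le.1 hi).le.trans hn
  cases hj : P.typeOf (x i)
  · exact .inl ⟨hj, hle⟩
  · exact .inr ⟨hj, hle⟩

lemma measure_lt_leastLoss (hν : HasPoissonPGFL (fun i x => x i) P.linkIntensity ν)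
    (j : LinkType) (s : ℝ≥0) :
    ν {x | s < P.leastLoss j x} = ENNReal.ofReal (P.lossTail j s) := by
  refine (measure_congr ?_).trans (hν.measure_forall_notMem (P.measurableSet_lossRegion j s)
    (P.linkIntensity_lossRegion_ne_top j s))
  filter_upwards [P.ae_tendsto_lossOf hν] with x hx
  exact propext (P.lt_leastLoss_iff hx j s)

lemma measure_lt_leastLoss_and (hν : HasPoissonPGFL (fun i x => x i) P.linkIntensity ν)
    (s t : ℝ≥0) : ν {x | s < P.leastLoss .los x ∧ t < P.leastLoss .nlos x} =
      ENNReal.ofReal (P.lossTail .los s) * ENNReal.ofReal (P.lossTail .nlos t) := by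
  have hdisj : Disjoint (P.lossRegion .los s) (P.lossRegion .nlos t) :=
    disjoint_left.2 fun z hz hz' => by simpa [hz.1] using hz'.1
  have hunion := measure_union hdisj (μ := P.linkIntensity) (P.measurableSet_lossRegion .nlos t)
  have hlos := P.linkIntensity_lossRegion_ne_top .los s
  have hnlos := P.linkIntensity_lossRegion_ne_top .nlos t
  have havoid := hν.measure_forall_notMem ((P.measurableSet_lossRegion .los s).union
    (P.measurableSet_lossRegion .nlos t)) (hunion ▸ ENNReal.add_ne_top.2 ⟨hlos, hnlos⟩)
  rw [hunion, ENNReal.toReal_add hlos hnlos, neg_add, Real.exp_add,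
    ENNReal.ofReal_mul (Real.exp_pos _).le] at havoid
  refine (measure_congr ?_).trans havoid
  filter_upwards [P.ae_tendsto_lossOf hν] with x hx
  refine propext ?_
  simp only [mem_union, not_or, forall_and]
  exact and_congr (P.lt_leastLoss_iff hx .los s) (P.lt_leastLoss_iff hx .nlos t)

lemma indepFun_leastLoss (hν : HasPoissonPGFL (fun i x => x i) P.linkIntensity ν) (j : LinkType) :
    IndepFun (P.leastLoss j) (P.leastLoss j.other) ν := by
  have h : IndepFun (P.leastLoss .los) (P.leastLoss .nlos) ν :=
    indepFun_of_measure_lt_and_lt (P.measurable_leastLoss _) (P.measurable_leastLoss _)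
      fun s t => by
        rw [P.measure_lt_leastLoss_and hν, P.measure_lt_leastLoss hν, P.measure_lt_leastLoss hν]
  cases j
  · exact h
  · exact h.symm

lemma map_toReal_leastLoss (hν : HasPoissonPGFL (fun i x => x i) P.linkIntensity ν)
    (j : LinkType) :
    (ν.restrict {x | P.leastLoss j x < ∞}).map (fun x => (P.leastLoss j x).toReal) =
      (volume.restrict (Ioi 0)).withDensity fun l => ENNReal.ofReal (P.lossDensity j l) := by
  refine Measure.ext_of_Iic _ _ fun a => ?_
  rw [Measure.map_apply (by fun_prop) measurableSet_Iic, Measure.restrict_apply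
    (measurableSet_Iic.preimage (by fun_prop)), withDensity_apply _ measurableSet_Iic,
    Measure.restrict_restrict measurableSet_Iic, inter_comm (Iic a), Ioi_inter_Iic]
  rcases lt_or_ge a 0 with ha | ha
  · have hempty : (fun x => (P.leastLoss j x).toReal) ⁻¹' Iic a = ∅ :=
      eq_empty_of_forall_notMem fun x hx => (hx.trans_lt ha).not_ge ENNReal.toReal_nonneg
    simp [hempty, Ioc_eq_empty (not_lt.2 ha.le)]
  · lift a to ℝ≥0 using ha
    have hcompl : (fun x => (P.leastLoss j x).toReal) ⁻¹' Iic (a : ℝ) ∩ {x | P.leastLoss j x < ∞} =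
        {x | a < P.leastLoss j x}ᶜ := by
      ext x
      simp only [mem_inter_iff, mem_preimage, mem_Iic, mem_ofPred_eq, mem_compl_iff, not_lt]
      refine ⟨fun h => ?_, fun h => ⟨ENNReal.toReal_mono ENNReal.coe_ne_top h,
        h.trans_lt ENNReal.coe_lt_top⟩⟩
      exact ((ENNReal.le_ofReal_iff_toReal_le h.2.ne a.2).2 h.1).trans_eq ENNReal.ofReal_coe_nnreal
    rw [hcompl, prob_compl_eq_one_sub (measurableSet_lt measurable_const (by fun_prop)),
      P.measure_lt_leastLoss hν, P.setLIntegral_lossDensity j a.coe_nonneg]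

lemma setLIntegral_leastLoss (hν : HasPoissonPGFL (fun i x => x i) P.linkIntensity ν)
    (j : LinkType) {H : ℝ → ℝ≥0∞} (hH : Measurable H) :
    ∫⁻ x in {x | P.leastLoss j x < ∞}, H (P.leastLoss j x).toReal ∂ν =
      ∫⁻ l in Ioi 0, ENNReal.ofReal (P.lossDensity j l) * H l := by
  rw [← lintegral_map hH (by fun_prop), P.map_toReal_leastLoss hν,
    lintegral_withDensity_eq_lintegral_mul₀' _ hH.aemeasurable]
  · rfl
  · exact (P.integrableOn_lossDensity j).aemeasurable.ennreal_ofReal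

lemma measure_leastLoss_eq (hν : HasPoissonPGFL (fun i x => x i) P.linkIntensity ν)
    (j : LinkType) {t : ℝ≥0∞} (ht : t < ∞) : ν {x | P.leastLoss j x = t} = 0 := by
  have hdens : (volume.restrict (Ioi 0)).withDensity
      (fun l => ENNReal.ofReal (P.lossDensity j l)) {t.toReal} = 0 :=
    withDensity_absolutelyContinuous _ _ (by simp)
  rw [← P.map_toReal_leastLoss hν, Measure.map_apply (by fun_prop) (measurableSet_singleton _),
    Measure.restrict_apply ((measurableSet_singleton _).preimage (by fun_prop))] at hdens
  refine measure_mono_null (fun x hx => ?_) hdens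
  rw [mem_ofPred_eq] at hx
  simp [hx, ht]

lemma ae_typeOf_servingLink_eq_iff (hν : HasPoissonPGFL (fun i x => x i) P.linkIntensity ν)
    (j : LinkType) : ∀ᵐ x ∂ν,
      P.typeOf (P.servingLink x) = j ↔ P.leastLoss j x < P.leastLoss j.other x := by
  have hne : ∀ᵐ x ∂ν, ∀ k, P.leastLoss k x < ∞ → P.leastLoss k.other x ≠ P.leastLoss k x :=
    ae_all_iff.2 fun k => ae_ne_of_indepFun (P.measurable_leastLoss _) (P.measurable_leastLoss _)
      (P.indepFun_leastLoss hν k) measurableSet_Iio fun t ht => P.measure_leastLoss_eq hν _ ht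
  filter_upwards [P.ae_tendsto_lossOf hν, hne] with x hx hxne
  exact P.typeOf_servingLink_eq_iff hx hxne j

-- The least path losses of the two types are independent, and the type of the smaller one serves.
lemma setLIntegral_lossOf_servingLink
    (hν : HasPoissonPGFL (fun i x => x i) P.linkIntensity ν) (j : LinkType) {H : ℝ → ℝ≥0∞}
    (hH : Measurable H) :
    ∫⁻ x in {x | P.typeOf (P.servingLink x) = j}, H (P.lossOf (P.servingLink x)) ∂ν =
      ∫⁻ l in Ioi 0, H l * ENNReal.ofReal (P.lossTail j.other l * P.lossDensity j l) := by
  have hserving : {x | P.typeOf (P.servingLink x) = j} =ᵐ[ν]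
      {x | P.leastLoss j x < P.leastLoss j.other x} :=
    (P.ae_typeOf_servingLink_eq_iff hν j).mono fun x hx => propext hx
  have hmeas : MeasurableSet {x | P.typeOf (P.servingLink x) = j} :=
    (measurableSet_singleton j).preimage (P.measurable_typeOf.comp P.measurable_servingLink)
  have htail (t : ℝ≥0∞) : H t.toReal * ν.map (P.leastLoss j.other) (Ioi t) = (Iio ∞).indicator
      (fun t => H t.toReal * ENNReal.ofReal (P.lossTail j.other t.toReal)) t := by
    rw [Measure.map_apply (P.measurable_leastLoss _) measurableSet_Ioi]
    induction t with
    | top => simp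
    | coe t => simp [← P.measure_lt_leastLoss hν, Ioi]
  calc ∫⁻ x in {x | P.typeOf (P.servingLink x) = j}, H (P.lossOf (P.servingLink x)) ∂ν
      = ∫⁻ x in {x | P.typeOf (P.servingLink x) = j}, H (P.leastLoss j x).toReal ∂ν := by
        refine setLIntegral_congr_fun_ae hmeas ?_
        filter_upwards [P.ae_tendsto_lossOf hν] with x hx hj
        rw [← hj, P.leastLoss_typeOf_servingLink hx, ENNReal.toReal_ofReal (P.lossOf_pos _).le]
    _ = ∫⁻ x in {x | P.leastLoss j x < P.leastLoss j.other x}, H (P.leastLoss j x).toReal ∂ν := by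
        rw [Measure.restrict_congr_set hserving]
    _ = ∫⁻ x in {x | P.leastLoss j x < ∞},
          H (P.leastLoss j x).toReal * ENNReal.ofReal (P.lossTail j.other (P.leastLoss j x).toReal)
            ∂ν := by
        rw [setLIntegral_lt_of_indepFun (H := fun t => H t.toReal) (P.measurable_leastLoss j)
          (P.measurable_leastLoss j.other) (P.indepFun_leastLoss hν j) (by fun_prop),
          ← lintegral_indicator (measurableSet_lt (by fun_prop) measurable_const)]
        exact lintegral_congr fun x => htail _
    _ = ∫⁻ l in Ioi 0, H l * ENNReal.ofReal (P.lossTail j.other l * P.lossDensity j l) := by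
        rw [P.setLIntegral_leastLoss hν j
          (H := fun l => H l * ENNReal.ofReal (P.lossTail j.other l))
          (hH.mul (P.antitone_lossTail _).measurable.ennreal_ofReal)]
        refine lintegral_congr fun l => ?_
        rw [ENNReal.ofReal_mul (P.lossTail_pos _ _).le]
        ring

end PoissonLinks

end Params

/-- The values of the fading gains, the zero-forcing penalties and the load. -/
abbrev Marks := (ℕ → ℕ → ℂ) × (LinkType → ℕ → ℝ) × ℕ

namespace Network

variable {P : Params} {Ω : Type*} [MeasurableSpace Ω] {μ : Measure Ω} (W : Network P μ)

section Links

/-- The link from BS `i` to the typical user. -/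
def link (i : ℕ) (ω : Ω) : Link := ((W.loc i ω, fun j => W.shadow j i ω), W.unblocked i ω)

/-- The sources of randomness that do not belong to the configuration of links. -/
def marks (ω : Ω) : Marks := (fun i k => W.fading i k ω, fun j U => W.zf j U ω, W.load ω)

lemma measurable_shadows (i : ℕ) : Measurable fun ω j => W.shadow j i ω :=
  measurable_pi_iff.2 fun j => W.shadow_measurable j i

lemma measurable_link (i : ℕ) : Measurable (W.link i) :=
  ((W.loc_poisson.measurable i).prodMk (W.measurable_shadows i)).prodMk (W.unblocked_measurable i)

lemma measurable_marks : Measurable W.marks :=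
  (measurable_pi_iff.2 fun i => measurable_pi_iff.2 (W.fading_measurable i)).prodMk
    ((measurable_pi_iff.2 fun j => measurable_pi_iff.2 (W.zf_measurable j)).prodMk
      W.load_measurable)

lemma iIndepFun_shadows : iIndepFun (fun i ω j => W.shadow j i ω) μ :=
  iIndepFun_curry (fun i j => W.shadow_measurable j i)
    (W.shadow_indep.precomp (g := Prod.swap) Prod.swap_injective)

lemma map_shadows (i : ℕ) :
    μ.map (fun ω j => W.shadow j i ω) = Measure.infinitePi P.shadowLaw := by
  have hind : iIndepFun (fun j => W.shadow j i) μ :=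
    W.shadow_indep.precomp (g := fun j => (j, i)) fun _ _ h => congrArg Prod.fst h
  rw [hind.map_fun_eq_infinitePi_map fun j => W.shadow_measurable j i]
  exact congrArg Measure.infinitePi (funext fun j => W.shadow_law j i)

variable [IsProbabilityMeasure μ]

lemma map_unblocked (i : ℕ) : μ.map (W.unblocked i) = P.unblockedLaw := by
  have := Measure.isProbabilityMeasure_map (μ := μ) (W.unblocked_measurable i).aemeasurable
  have htrue : μ.map (W.unblocked i) {true} = P.unblockedLaw {true} := by
    rw [Measure.map_apply (W.unblocked_measurable i) (measurableSet_singleton _),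
      P.unblockedLaw_true, ← W.unblocked_law i, ofReal_measureReal]
    rfl
  have hcompl : ({false} : Set Bool) = {true}ᶜ := by ext b; cases b <;> simp
  refine Measure.ext_of_singleton fun b => ?_
  cases b
  · rw [hcompl, prob_compl_eq_one_sub (measurableSet_singleton _), htrue,
      prob_compl_eq_one_sub (measurableSet_singleton _)]
  · exact htrue

lemma indepFun_link_marks : IndepFun (fun ω i => W.link i ω) W.marks μ := by
  have hloc : Measurable fun ω i => W.loc i ω := measurable_pi_iff.2 W.loc_poisson.measurable
  have hunb : Measurable fun ω i => W.unblocked i ω := measurable_pi_iff.2 W.unblocked_measurable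
  have hshadow : Measurable fun ω j i => W.shadow j i ω :=
    measurable_pi_iff.2 fun j => measurable_pi_iff.2 (W.shadow_measurable j)
  have hunb_shadow : IndepFun
      (fun ω => (fun i => W.unblocked i ω, fun j i => W.shadow j i ω)) W.marks μ :=
    indepFun_prodMk_left hunb hshadow W.measurable_marks W.indep_unblocked W.indep_shadow
  have hloc_rest : IndepFun (fun ω i => W.loc i ω)
      (fun ω => ((fun i => W.unblocked i ω, fun j i => W.shadow j i ω), W.marks ω)) μ :=
    W.indep_loc.comp measurable_id MeasurableEquiv.prodAssoc.symm.measurable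
  have hform : Measurable fun (z : (ℕ → EuclideanSpace ℝ (Fin 2)) × (ℕ → Bool) ×
      (LinkType → ℕ → ℝ)) i => (((z.1 i, fun j => z.2.2 j i), z.2.1 i) : Link) := by fun_prop
  exact (indepFun_prodMk_left hloc (hunb.prodMk hshadow) W.measurable_marks hloc_rest
    hunb_shadow).comp hform measurable_id

lemma hasPoissonPGFL_link : HasPoissonPGFL W.link P.linkIntensity μ := by
  have hloc : Measurable fun ω i => W.loc i ω := measurable_pi_iff.2 W.loc_poisson.measurable
  have hunb : Measurable fun ω i => W.unblocked i ω := measurable_pi_iff.2 W.unblocked_measurable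
  have hshadow : Measurable fun ω i j => W.shadow j i ω := measurable_pi_iff.2 W.measurable_shadows
  have hloc_shadow : IndepFun (fun ω i => W.loc i ω) (fun ω i j => W.shadow j i ω) μ :=
    W.indep_loc.comp measurable_id (ψ := fun (z : (ℕ → Bool) × (LinkType → ℕ → ℝ) × Marks) i j =>
      z.2.1 j i) (by fun_prop)
  have hloc_rest : IndepFun (fun ω i => W.loc i ω)
      (fun ω => (fun i j => W.shadow j i ω, fun i => W.unblocked i ω)) μ :=
    W.indep_loc.comp measurable_id (ψ := fun z : (ℕ → Bool) × (LinkType → ℕ → ℝ) × Marks =>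
      (fun i j => z.2.1 j i, z.1)) (by fun_prop)
  have hunb_shadow : IndepFun (fun ω i => W.unblocked i ω) (fun ω i j => W.shadow j i ω) μ :=
    W.indep_unblocked.comp measurable_id (ψ := fun (z : (LinkType → ℕ → ℝ) × Marks) i j =>
      z.1 j i) (by fun_prop)
  have hform : Measurable fun (z : (ℕ → EuclideanSpace ℝ (Fin 2)) × (ℕ → LinkType → ℝ)) i =>
      (z.1 i, z.2 i) := by fun_prop
  exact (W.loc_poisson.hasPoissonPGFL.prodMk W.measurable_shadows W.map_shadows
    W.iIndepFun_shadows hloc_shadow).prodMk W.unblocked_measurable W.map_unblocked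
      W.unblocked_indep ((indepFun_prodMk_left hloc hshadow hunb hloc_rest
        hunb_shadow.symm).comp hform measurable_id)

lemma setLIntegral_loss_tagged (j : LinkType) {H : ℝ → ℝ≥0∞} (hH : Measurable H) :
    ∫⁻ ω in {ω | W.servingType ω = j}, H (W.loss (W.tagged ω) ω) ∂μ =
      ∫⁻ l in Ioi 0, H l * ENNReal.ofReal (P.lossTail j.other l * P.lossDensity j l) := by
  have hlink : Measurable fun ω i => W.link i ω := measurable_pi_iff.2 W.measurable_link
  have := Measure.isProbabilityMeasure_map (μ := μ) hlink.aemeasurable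
  have htype : MeasurableSet {x : ℕ → Link | P.typeOf (P.servingLink x) = j} :=
    (measurableSet_singleton j).preimage (P.measurable_typeOf.comp P.measurable_servingLink)
  have hloss : Measurable fun x : ℕ → Link => H (P.lossOf (P.servingLink x)) :=
    hH.comp (P.measurable_lossOf.comp P.measurable_servingLink)
  exact (setLIntegral_map htype hloss hlink).symm.trans
    (P.setLIntegral_lossOf_servingLink W.hasPoissonPGFL_link.map_pi j hH)

end Links

section Coverage

lemma kappa_nonneg (W : Network P μ) (n : ℕ) : 0 ≤ P.kappa n := W.load_law n ▸ measureReal_nonneg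

lemma zeta_nonneg (W : Network P μ) (j : LinkType) {U : ℕ} (hU : 1 ≤ U) : 0 ≤ P.zeta (P.η j) U :=
  W.zf_law j U hU ▸ measureReal_nonneg

/-- The event that the serving link has type `j`, that its best path has fading power more than
`a` times the path loss, that zero-forcing to `U` users succeeds on it, and that the load is
`n`. -/
def coverage (j : LinkType) (a : ℝ) (U n : ℕ) : Set Ω :=
  {ω | W.servingType ω = j ∧ a * W.loss (W.tagged ω) ω < ⨆ k : Fin (P.η j),
    ‖W.fading (W.tagged ω) k ω‖ ^ 2 ∧ W.zf j U ω = 1 ∧ W.load ω = n}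

lemma measurableSet_prodMk_coverage (P : Params) (j : LinkType) (a : ℝ) (U n : ℕ) :
    MeasurableSet {z : (ℕ → Link) × Marks | P.typeOf (P.servingLink z.1) = j ∧
      a * P.lossOf (P.servingLink z.1) < ⨆ k : Fin (P.η j), ‖z.2.1 (P.servingIndex z.1) k‖ ^ 2 ∧
      z.2.2.1 j U = 1 ∧ z.2.2.2 = n} := by
  have hserving : Measurable fun z : (ℕ → Link) × Marks => P.servingLink z.1 :=
    P.measurable_servingLink.comp measurable_fst
  have hfading (k : ℕ) :
      Measurable fun z : (ℕ → Link) × Marks => z.2.1 (P.servingIndex z.1) k :=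
    (measurable_from_prod_countable_right (f := fun z : ℕ × (ℕ → ℕ → ℂ) => z.2 z.1 k)
      fun i => by fun_prop).comp ((P.measurable_servingIndex.comp measurable_fst).prodMk
        (measurable_fst.comp measurable_snd))
  simp only [ofPred_and]
  refine (P.measurable_typeOf.comp hserving (measurableSet_singleton j)).inter (.inter ?_
    ((measurableSet_eq_fun (by fun_prop) measurable_const).inter
      (measurableSet_eq_fun (by fun_prop) measurable_const)))
  exact measurableSet_lt ((P.measurable_lossOf.comp hserving).const_mul a)
    (.iSup fun k => (hfading k).norm.pow_const 2)

lemma measurableSet_coverage (j : LinkType) (a : ℝ) (U n : ℕ) :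
    MeasurableSet (W.coverage j a U n) :=
  (measurableSet_prodMk_coverage P j a U n).preimage
    ((measurable_pi_iff.2 W.measurable_link).prodMk W.measurable_marks)

variable [IsProbabilityMeasure μ]

lemma measureReal_lt_iSup_fading (i : ℕ) {N : ℕ} (hN : 0 < N) {x : ℝ} (hx : 0 ≤ x) :
    μ.real {ω | x < ⨆ k : Fin N, ‖W.fading i k ω‖ ^ 2} = fadingTail N x := by
  have hind : iIndepFun (fun k : Fin N => W.fading i k) μ :=
    W.fading_indep.precomp (g := fun k : Fin N => (i, (k : ℕ)))
      fun _ _ h => Fin.ext (congrArg Prod.snd h)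
  refine measure_lt_iSup_of_iIndepFun hN (fun k => (W.fading_measurable i k).norm.pow_const 2)
    (hind.comp (fun _ z => ‖z‖ ^ 2) fun _ => by fun_prop) fun k => ?_
  rw [← complexNormal_real_lt_norm_sq hx, ← W.fading_law i k, map_measureReal_apply
    (W.fading_measurable i k) (measurableSet_lt measurable_const (by fun_prop))]
  rfl

lemma measure_lt_iSup_fading_and_zf_and_load (i : ℕ) (j : LinkType) {x : ℝ} (hx : 0 ≤ x) {U : ℕ}
    (hU : 1 ≤ U) (n : ℕ) :
    μ {ω | x < ⨆ k : Fin (P.η j), ‖W.fading i k ω‖ ^ 2 ∧ W.zf j U ω = 1 ∧ W.load ω = n} =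
      ENNReal.ofReal (fadingTail (P.η j) x) *
        (ENNReal.ofReal (P.zeta (P.η j) U) * ENNReal.ofReal (P.kappa n)) := by
  have hfading : MeasurableSet {z : ℕ → ℕ → ℂ | x < ⨆ k : Fin (P.η j), ‖z i k‖ ^ 2} :=
    measurableSet_lt measurable_const (.iSup fun k => by fun_prop)
  have hzf : MeasurableSet {z : LinkType → ℕ → ℝ | z j U = 1} :=
    measurableSet_eq_fun (by fun_prop) measurable_const
  rw [← W.measureReal_lt_iSup_fading i (P.η_pos j) hx, ← W.zf_law j U hU, ← W.load_law n,
    ofReal_measureReal, ofReal_measureReal, ofReal_measureReal]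
  exact (W.indep_fading.measure_inter_preimage_eq_mul _ _ hfading
    (hzf.prod (measurableSet_singleton n))).trans
      (congrArg _ (W.indep_zf.measure_inter_preimage_eq_mul _ _ hzf (measurableSet_singleton n)))

lemma measure_coverage (j : LinkType) {a : ℝ} (ha : 0 ≤ a) {U : ℕ} (hU : 1 ≤ U) (n : ℕ) :
    μ (W.coverage j a U n) = (∫⁻ l in Ioi 0, ENNReal.ofReal (fadingTail (P.η j) (a * l)) *
        ENNReal.ofReal (P.lossTail j.other l * P.lossDensity j l)) *
      (ENNReal.ofReal (P.zeta (P.η j) U) * ENNReal.ofReal (P.kappa n)) := by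
  classical
  have hlink : Measurable fun ω i => W.link i ω := measurable_pi_iff.2 W.measurable_link
  have htype : MeasurableSet {ω | W.servingType ω = j} := (measurableSet_singleton j).preimage
    (P.measurable_typeOf.comp (P.measurable_servingLink.comp hlink))
  have hmarks (ω : Ω) : μ {ω' | W.servingType ω = j ∧ a * W.loss (W.tagged ω) ω <
      ⨆ k : Fin (P.η j), ‖W.fading (W.tagged ω) k ω'‖ ^ 2 ∧ W.zf j U ω' = 1 ∧ W.load ω' = n} =
      {ω | W.servingType ω = j}.indicator (fun ω =>
        ENNReal.ofReal (fadingTail (P.η j) (a * W.loss (W.tagged ω) ω)) *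
          (ENNReal.ofReal (P.zeta (P.η j) U) * ENNReal.ofReal (P.kappa n))) ω := by
    by_cases hω : W.servingType ω = j
    · have hloss : 0 < W.loss (W.tagged ω) ω := P.pathLoss_pos _ _ _
      simp [hω, W.measure_lt_iSup_fading_and_zf_and_load _ j (mul_nonneg ha hloss.le) hU n]
    · simp [hω]
  calc μ (W.coverage j a U n)
      = ∫⁻ ω, μ {ω' | W.servingType ω = j ∧ a * W.loss (W.tagged ω) ω <
          ⨆ k : Fin (P.η j), ‖W.fading (W.tagged ω) k ω'‖ ^ 2 ∧ W.zf j U ω' = 1 ∧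
            W.load ω' = n} ∂μ :=
        measure_prodMk_mem_of_indepFun hlink W.measurable_marks W.indepFun_link_marks
          (measurableSet_prodMk_coverage P j a U n)
    _ = ∫⁻ ω in {ω | W.servingType ω = j},
          ENNReal.ofReal (fadingTail (P.η j) (a * W.loss (W.tagged ω) ω)) *
            (ENNReal.ofReal (P.zeta (P.η j) U) * ENNReal.ofReal (P.kappa n)) ∂μ := by
        simp_rw [hmarks]
        exact lintegral_indicator htype _
    _ = _ := by
        rw [lintegral_mul_const' _ _ (by finiteness), W.setLIntegral_loss_tagged j
          (H := fun l => ENNReal.ofReal (fadingTail (P.η j) (a * l))) (by fun_prop)]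

lemma measureReal_coverage (j : LinkType) {τ : ℝ} (hτ : 0 ≤ τ) {U : ℕ} (hU : 1 ≤ U) (n : ℕ) :
    μ.real (W.coverage j (P.fadingThreshold j τ U) U n) = P.kappa n * P.covTerm j τ U := by
  have hζ := W.zeta_nonneg j hU
  rw [measureReal_def, W.measure_coverage j (P.fadingThreshold_nonneg j hτ U) hU n, ← mul_assoc,
    mul_comm (∫⁻ _ in _, _), ← P.ofReal_covTerm j hτ hζ,
    ← ENNReal.ofReal_mul (P.covTerm_nonneg j hτ hζ), ENNReal.toReal_ofReal
      (mul_nonneg (P.covTerm_nonneg j hτ hζ) (W.kappa_nonneg n)), mul_comm]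

end Coverage

section Rate

lemma bestFading_nonneg (ω : Ω) : 0 ≤ W.bestFading ω := Real.iSup_nonneg fun _ => by positivity

lemma lt_snr_iff {T : ℝ} (hT : 0 ≤ T) {ω : Ω} (hU : 0 < W.numServed ω) :
    T < W.snr ω ↔ P.fadingThreshold (W.servingType ω) T (W.numServed ω) * W.loss (W.tagged ω) ω <
      W.bestFading ω ∧ W.zf (W.servingType ω) (W.numServed ω) ω = 1 := by
  have hη : 0 < P.η (W.servingType ω) := P.η_pos _
  have hG := P.G_pos
  have hnoise := P.noise_pos
  have hloss : 0 < W.loss (W.tagged ω) ω := P.pathLoss_pos _ _ _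
  rcases W.zf_range (W.servingType ω) (W.numServed ω) ω with hzf | hzf
  · simp [snr, hzf, hT]
  · have hsnr : W.snr ω = W.bestFading ω / (P.η (W.servingType ω) * W.numServed ω * P.noise / P.G *
        W.loss (W.tagged ω) ω) := by
      rw [snr, hzf]
      field_simp
    rw [hsnr, lt_div_iff₀ (by positivity), Params.fadingThreshold, and_iff_left hzf]
    ring_nf

lemma rate_gt_iff {τ : ℝ} {ω : Ω} (hload : 0 < W.load ω) :
    W.rate ω > τ ↔ P.snrThreshold τ (W.load ω) < W.snr ω := by
  have hU : 0 < min (W.load ω) P.UM := lt_min hload P.UM_pos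
  have hbandwidth := P.bandwidth_pos
  have heff := P.eff_pos
  have hsnr : 0 ≤ W.snr ω := by
    have hzf : 0 ≤ W.zf (W.servingType ω) (W.numServed ω) ω := by
      rcases W.zf_range (W.servingType ω) (W.numServed ω) ω with h | h <;> simp [h]
    have := P.G_pos
    have := P.noise_pos
    have hloss : 0 < W.loss (W.tagged ω) ω := P.pathLoss_pos _ _ _
    have := W.bestFading_nonneg ω
    unfold snr
    positivity
  have hrate : W.rate ω = Real.logb 2 (1 + W.snr ω) /
      (W.load ω / (P.eff * P.bandwidth * (min (W.load ω) P.UM : ℕ))) := by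
    rw [rate, numServed, min_comm]
    field_simp
  rw [Params.snrThreshold, sub_lt_iff_lt_add',
    ← Real.lt_logb_iff_rpow_lt one_lt_two (by positivity), hrate, gt_iff_lt,
    lt_div_iff₀ (by positivity), mul_div_assoc]

lemma setOf_rate_gt_and_load {τ : ℝ} (hτ : 0 ≤ τ) {n : ℕ} (hn : 0 < n) :
    {ω | W.rate ω > τ ∧ W.load ω = n} = ⋃ j, W.coverage j
      (P.fadingThreshold j (P.snrThreshold τ n) (min n P.UM)) (min n P.UM) n := by
  ext ω
  simp only [mem_ofPred_eq, mem_iUnion, coverage, exists_eq_left']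
  rw [← and_assoc]
  refine and_congr_left ?_
  rintro rfl
  have hserved : W.numServed ω = min (W.load ω) P.UM := min_comm _ _
  rw [W.rate_gt_iff hn, W.lt_snr_iff (P.snrThreshold_nonneg hτ _)
    (hserved ▸ lt_min hn P.UM_pos), hserved]
  rfl

variable [IsProbabilityMeasure μ]

lemma measureReal_rate_gt_and_load {τ : ℝ} (hτ : 0 ≤ τ) {n : ℕ} (hn : 0 < n) :
    μ.real {ω | W.rate ω > τ ∧ W.load ω = n} =
      P.kappa n * P.S (P.snrThreshold τ n) (min n P.UM) := by
  have hU : 1 ≤ min n P.UM := le_min hn P.UM_pos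
  have hd : Pairwise (Function.onFun Disjoint fun j => W.coverage j
      (P.fadingThreshold j (P.snrThreshold τ n) (min n P.UM)) (min n P.UM) n) :=
    fun j j' hne => Set.disjoint_left.2 fun ω hj hj' => hne (hj.1.symm.trans hj'.1)
  rw [W.setOf_rate_gt_and_load hτ hn, measureReal_iUnion_fintype hd
    fun j => W.measurableSet_coverage j _ _ _]
  simp_rw [W.measureReal_coverage _ (P.snrThreshold_nonneg hτ n) hU n, ← Finset.mul_sum]
  exact congrArg (P.kappa n * ·) (by simp [Params.S, Finset.univ, Fintype.elems])

lemma hasSum_rate {τ : ℝ} (hτ : 0 ≤ τ) :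
    HasSum (fun n : ℕ+ => P.kappa n * P.S (P.snrThreshold τ n) (min n P.UM))
      (μ.real {ω | W.rate ω > τ}) := by
  have hload : ∀ᵐ ω ∂μ, W.load ω ≠ 0 := by
    have h := W.load_law 0
    rw [Params.kappa, if_pos rfl, measureReal_eq_zero_iff] at h
    simpa [ae_iff] using h
  have hunion : {ω | W.rate ω > τ} =ᵐ[μ] ⋃ n : ℕ+, {ω | W.rate ω > τ ∧ W.load ω = n} := by
    filter_upwards [hload] with ω hω
    refine propext ⟨fun h => mem_iUnion.2 ⟨⟨W.load ω, Nat.pos_of_ne_zero hω⟩, h, rfl⟩, fun h => ?_⟩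
    obtain ⟨n, hn⟩ := mem_iUnion.1 h
    exact hn.1
  have hd : Pairwise (Function.onFun Disjoint fun n : ℕ+ => {ω | W.rate ω > τ ∧ W.load ω = n}) :=
    fun n m hne => Set.disjoint_left.2 fun ω hn hm =>
      hne (PNat.coe_injective (hn.2.symm.trans hm.2))
  simp_rw [← W.measureReal_rate_gt_and_load hτ (PNat.pos _)]
  rw [measureReal_congr hunion]
  exact hasSum_measureReal_iUnion hd fun n => by
    rw [W.setOf_rate_gt_and_load hτ n.pos]
    exact .iUnion fun j => W.measurableSet_coverage j _ _ _

end Rate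

end Network

end MmWave

theorem theorem2 {Ω : Type*} [MeasurableSpace Ω] (μ : MeasureTheory.Measure Ω)
    [MeasureTheory.IsProbabilityMeasure μ] (P : MmWave.Params) (W : MmWave.Network P μ)
    (τ : ℝ) (hτ : 0 ≤ τ) :
    (∀ (j : MmWave.LinkType) (n : ℕ+), ∀ k ∈ Finset.Icc 1 (P.η j),
      MeasureTheory.IntegrableOn
        (P.covIntegrand j (P.snrThreshold τ n) (min n P.UM) k) (Set.Ioi 0)) ∧
    HasSum (fun n : ℕ+ => P.kappa n * P.S (P.snrThreshold τ n) (min n P.UM))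
      (μ.real {ω | W.rate ω > τ}) :=
  ⟨fun j n k _ => P.integrableOn_covIntegrand j (P.snrThreshold_nonneg hτ n) (min n P.UM) k,
    W.hasSum_rate hτ⟩
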